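/- Let $\mathcal{E}$ be an elementary topos (with chosen finite products) and $(Q,\otimes,k,\bigvee)$ an internal commutative quantale in $\mathcal{E}$. *Relations.* A $Q$-relation $A\to B$ is a morphism $R:A\times B\to Q$. In the internal language, identities are $1_A(a,a')=\bigvee\{k\mid a=a'\}$, composition is $(S\circ R)(a,c)=\bigvee_b R(a,b)\otimes S(b,c)$, and the tensor of morphisms is $(R\otimes R')((a,a'),(b,b'))=R(a,b)\otimes R'(a',b')$. For a signature $\Sigma$ of finitary operation symbols with a set $E$ of equations, a $Q$-relation between the carriers of two $(\Sigma,E)$-algebras in $\mathcal{E}$ is algebraic if $R(a_1,b_1)\otimes\dots\otimes R(a_n,b_n)\le R(\sigma(a_1,\dots,a_n),\sigma(b_1,\dots,b_n))$ for every $n$-ary $\sigma\in\Sigma$. It is affine if $R(a_1,b_1)\otimes R(a_2,b_2)\le R(a_1,b_1)$, relevant if $R(a,b)\le R(a,b)\otimes R(a,b)$, cartesian if affine and relevant, and linear without further condition. For each $\kappa\in\{\text{linear, affine, relevant, cartesian}\}$, let $\mathbf{Rel}^\kappa_{(\Sigma,E)}(Q)$ be the category of $(\Sigma,E)$-algebras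 and algebraic $Q$-relations of kind $\kappa$. It is monoidal: the tensor of objects is the product of algebras, the unit is the terminal algebra, and the coherence isomorphisms are the graphs $f_\circ(a,b)=\bigvee\{k\mid f(a)=b\}$ of those of $\mathcal{E}$. *Interpretations.* A term over a finite set of variables is linear (affine, relevant, cartesian) if it uses each of these variables exactly once (at most once, at least once, without restriction). An interpretation $i:(\Sigma_1,E_1)\to(\Sigma_2,E_2)$ of kind $\kappa$ assigns to each $\sigma\in\Sigma_1$ a term $i(\sigma)$ over $\Sigma_2$ of the same arity and of kind $\kappa$, such that the translations of the equations $E_1$ are provable from $E_2$ in equational logic. Signatures with equations and interpretations of kind $\kappa$ form a category, with composition by substitution. **Theorem.** Let $\kappa$ be any of the four kinds. Every interpretation $i:(\Sigma_1,E_1)\to(\Sigma_2,E_2)$ of kind $\kappa$ induces a strict monoidal functor $$i^*:\mathbf{Rel}^\kappa_{(\Sigma_2,E_2)}(Q)\to\mathbf{Rel}^\kappa_{(\Sigma_1,E_1)}(Q)$$ which sends an algebra $A$ to the algebra with the same carrier in which each $\sigma\in\Sigma_1$ is interpreted by the derived operation of $i(\sigma)$ in $A$, and which is the identity on underlying $Q$-relations.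 The assignment $i\mapsto i^*$ is contravariantly functorial: $(\mathrm{id})^*=\mathrm{id}$ and $(j\circ i)^*=i^*\circ j^*$. Moreover, every algebraic $Q$-relation $R:A\to B$ of kind $\kappa$ over any $(\Sigma,E)$ respects derived operations of kind $\kappa$: for every term $\tau$ of kind $\kappa$ in $n$ variables, $$R(a_1,b_1)\otimes\dots\otimes R(a_n,b_n)\le R(\tau(a_1,\dots,a_n),\tau(b_1,\dots,b_n)).$$ -/

import Mathlib

open CategoryTheory Category Limits MonoidalCategory CartesianMonoidalCategory
open scoped MonObj

universe w v u

namespace QRel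

noncomputable section

/-! ### Internal language of an elementary topos

The base category `E` is an elementary topos: it has chosen finite products, finite limits,
exponentials and a subobject classifier.  A formula in context `X` is a morphism `X ⟶ Ω`;
it is valid at stage `X` when it equals "true". -/

section Logic

variable {E : Type u} [Category.{v} E] [HasSubobjectClassifier E]

/-- The truth values object. -/
abbrev Om (E : Type u) [Category.{v} E] [HasSubobjectClassifier E] : E :=
  HasSubobjectClassifier.Ω E

/-- The formula "true" in context `X`. -/
def tt (X : E) : X ⟶ Om E :=
  Subobject.Classifier.χ₀ _ X ≫ HasSubobjectClassifier.truth E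

/-- Validity of a formula in context `X`. -/
def Holds {X : E} (φ : X ⟶ Om E) : Prop := φ = tt X

theorem comp_tt {X Y : E} (y : Y ⟶ X) : y ≫ tt X = tt Y := by
  unfold tt
  rw [← assoc]
  congr 1
  exact Subsingleton.elim _ _

theorem Holds.comp {X Y : E} {φ : X ⟶ Om E} (h : Holds φ) (y : Y ⟶ X) : Holds (y ≫ φ) := by
  unfold Holds at *
  rw [h, comp_tt]

theorem holds_χ_iff {U X Y : E} (m : U ⟶ X) [Mono m] (y : Y ⟶ X) :
    Holds (y ≫ HasSubobjectClassifier.χ m) ↔ ∃ l : Y ⟶ U, l ≫ m = y := by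
  constructor
  · intro h
    exact ⟨(HasSubobjectClassifier.isPullback_χ m).lift y (Subobject.Classifier.χ₀ _ Y) h,
      IsPullback.lift_fst _ _ _ _⟩
  · rintro ⟨l, rfl⟩
    have h : Holds (m ≫ HasSubobjectClassifier.χ m) :=
      (HasSubobjectClassifier.isPullback_χ m).w
    rw [assoc]
    exact h.comp l

theorem omega_ext [HasPullbacks E] {X : E} {φ ψ : X ⟶ Om E}
    (h : ∀ {Y : E} (y : Y ⟶ X), Holds (y ≫ φ) ↔ Holds (y ≫ ψ)) : φ = ψ := by
  obtain ⟨Z, i, hi, rfl⟩ := Subobject.Classifier.surjective_χ _ φ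
  obtain ⟨W, j, hj, rfl⟩ := Subobject.Classifier.surjective_χ _ ψ
  obtain ⟨a, ha⟩ := (holds_χ_iff j i).1 ((h i).1 ((holds_χ_iff i i).2 ⟨𝟙 _, id_comp _⟩))
  obtain ⟨b, hb⟩ := (holds_χ_iff i j).1 ((h j).2 ((holds_χ_iff j j).2 ⟨𝟙 _, id_comp _⟩))
  have hab : a ≫ b = 𝟙 Z := by rw [← cancel_mono i, assoc, hb, ha, id_comp]
  have hba : b ≫ a = 𝟙 W := by rw [← cancel_mono j, assoc, ha, hb, id_comp]
  refine HasSubobjectClassifier.unique j _ ?_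
  refine IsPullback.of_iso (HasSubobjectClassifier.isPullback_χ i) ⟨a, b, hab, hba⟩
    (Iso.refl _) (Iso.refl _) (Iso.refl _) ?_ ?_ ?_ ?_
  · simp [ha]
  · exact Subsingleton.elim _ _
  · simp; rfl
  · simp

variable [HasFiniteLimits E]

/-- The formula `f = g`. -/
def eqF {X Y : E} (f g : X ⟶ Y) : X ⟶ Om E :=
  HasSubobjectClassifier.χ (equalizer.ι f g)

theorem holds_eqF {X Y Z : E} (f g : X ⟶ Y) (z : Z ⟶ X) :
    Holds (z ≫ eqF f g) ↔ z ≫ f = z ≫ g := by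
  rw [eqF, holds_χ_iff]
  constructor
  · rintro ⟨l, rfl⟩
    rw [assoc, assoc, equalizer.condition]
  · intro h
    exact ⟨equalizer.lift z h, equalizer.lift_ι _ _⟩

variable [CartesianMonoidalCategory E]

/-- Conjunction `φ ∧ ψ`, as `(φ, ψ) = (true, true)`. -/
def andF {X : E} (φ ψ : X ⟶ Om E) : X ⟶ Om E :=
  eqF (lift φ ψ) (lift (tt X) (tt X))

theorem holds_andF {X Z : E} (φ ψ : X ⟶ Om E) (z : Z ⟶ X) :
    Holds (z ≫ andF φ ψ) ↔ Holds (z ≫ φ) ∧ Holds (z ≫ ψ) := by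
  rw [andF, holds_eqF, comp_lift, comp_lift, comp_tt]
  constructor
  · intro h
    have h₁ := h =≫ fst _ _
    have h₂ := h =≫ snd _ _
    simp only [lift_fst, lift_snd] at h₁ h₂
    exact ⟨h₁, h₂⟩
  · rintro ⟨h₁, h₂⟩
    rw [h₁, h₂]

/-- Implication `φ ⇒ ψ`, as `(φ ∧ ψ) = φ`. -/
def impF {X : E} (φ ψ : X ⟶ Om E) : X ⟶ Om E :=
  eqF (andF φ ψ) φ

theorem holds_impF {X Z : E} (φ ψ : X ⟶ Om E) (z : Z ⟶ X) :
    Holds (z ≫ impF φ ψ) ↔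
      ∀ {Y : E} (y : Y ⟶ Z), Holds (y ≫ z ≫ φ) → Holds (y ≫ z ≫ ψ) := by
  rw [impF, holds_eqF]
  constructor
  · intro h Y y hy
    rw [← h, ← assoc, holds_andF] at hy
    simpa using hy.2
  · intro h
    apply omega_ext
    intro Y y
    have := h y
    rw [← assoc, holds_andF, assoc, assoc]
    tauto

variable [MonoidalClosed E]

/-- Universal quantification `∀ z : Z, φ(z, x)`. -/
def allF (Z : E) {X : E} (φ : Z ⊗ X ⟶ Om E) : X ⟶ Om E :=
  eqF (MonoidalClosed.curry φ) (MonoidalClosed.curry (tt (Z ⊗ X)))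

theorem holds_allF {Z X W : E} (φ : Z ⊗ X ⟶ Om E) (x : W ⟶ X) :
    Holds (x ≫ allF Z φ) ↔
      ∀ {Y : E} (y : Y ⟶ W) (z : Y ⟶ Z), Holds (lift z (y ≫ x) ≫ φ) := by
  rw [allF, holds_eqF, ← MonoidalClosed.curry_natural_left, ← MonoidalClosed.curry_natural_left,
    MonoidalClosed.curry_injective.eq_iff, comp_tt]
  constructor
  · intro h Y y z
    have := Holds.comp (φ := Z ◁ x ≫ φ) h (lift z y)
    simpa using this
  · intro h
    have := h (snd Z W) (fst Z W)
    have e : lift (fst Z W) (snd Z W ≫ x) = Z ◁ x := by ext <;> simp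
    rwa [e] at this

/-- Existential quantification `∃ z : Z, φ(z, x)`, by the usual second order encoding
`∀ w : Ω, (∀ z : Z, φ(z, x) ⇒ w) ⇒ w`. -/
def exF (Z : E) {X : E} (φ : Z ⊗ X ⟶ Om E) : X ⟶ Om E :=
  allF (Om E) (impF
    (allF Z (impF ((Z ◁ snd (Om E) X) ≫ φ) (snd Z (Om E ⊗ X) ≫ fst (Om E) X)))
    (fst (Om E) X))

theorem holds_exF {Z X W : E} (φ : Z ⊗ X ⟶ Om E) (x : W ⟶ X) :
    Holds (x ≫ exF Z φ) ↔ ∀ {Y : E} (y : Y ⟶ W) (p : Y ⟶ Om E),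
      (∀ {V : E} (s : V ⟶ Y) (z : V ⟶ Z),
        Holds (lift z (s ≫ y ≫ x) ≫ φ) → Holds (s ≫ p)) → Holds p := by
  rw [exF, holds_allF]
  simp only [holds_impF]
  constructor
  · intro h Y y p hp
    have := h y p (𝟙 _) ?_
    · simpa using this
    · rw [← assoc, holds_allF]
      intro V s z
      rw [holds_impF]
      intro V' t ht
      have := hp (t ≫ s) (t ≫ z) (by simpa [comp_lift_assoc] using ht)
      simpa [comp_lift_assoc] using this
  · intro h Y y p V s hs
    rw [← assoc, holds_allF] at hs
    simp only [holds_impF] at hs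
    have := h (s ≫ y) (s ≫ p) ?_
    · simpa using this
    · intro V' t z hz
      have := hs t z (𝟙 _) (by simpa [comp_lift_assoc] using hz)
      simpa [comp_lift_assoc] using this

end Logic

/-! ### Internal quantales -/

section Quantale

variable {E : Type u} [Category.{v} E] [CartesianMonoidalCategory E] [HasFiniteLimits E]
  [MonoidalClosed E] [HasSubobjectClassifier E]

/-- The power object of `Q`. -/
abbrev PowObj (Q : E) : E := (ihom Q).obj (Om E)

/-- A subset of `Q` in context `X` is given by its membership predicate `S : Q ⊗ X ⟶ Ω`,
equivalently by the generalized element `curry S` of the power object. -/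
abbrev SubsetIn (Q X : E) := Q ⊗ X ⟶ Om E

/-- The subset `{a ⊗ b | b ∈ S}` of `Q`. -/
def mulLeftSet {Q : E} [MonObj Q] {X : E} (a : X ⟶ Q) (S : SubsetIn Q X) : SubsetIn Q X :=
  exF Q (andF ((Q ◁ snd Q X) ≫ S)
    (eqF (snd Q (Q ⊗ X) ≫ fst Q X) ((snd Q (Q ⊗ X) ≫ snd Q X ≫ a) * fst Q (Q ⊗ X))))

/-- The subset `{b ⊗ a | b ∈ S}` of `Q`. -/
def mulRightSet {Q : E} [MonObj Q] {X : E} (S : SubsetIn Q X) (a : X ⟶ Q) : SubsetIn Q X :=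
  exF Q (andF ((Q ◁ snd Q X) ≫ S)
    (eqF (snd Q (Q ⊗ X) ≫ fst Q X) (fst Q (Q ⊗ X) * (snd Q (Q ⊗ X) ≫ snd Q X ≫ a))))

/-- An internal quantale in the topos `E`: an internal monoid with an internal partial order,
an internal join operation `⋁ : P(Q) ⟶ Q` giving the least upper bound of every subset, over
which multiplication distributes on both sides.  Axioms in the internal language are written
out by their meaning for generalized elements at an arbitrary stage. -/
class InternalQuantale (Q : E) [MonObj Q] where
  /-- the order relation -/
  le : Q ⊗ Q ⟶ Om E
  /-- the join operation -/
  sup : PowObj Q ⟶ Q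
  le_refl : ∀ {X : E} (p : X ⟶ Q), Holds (lift p p ≫ le)
  le_trans : ∀ {X : E} (p q r : X ⟶ Q),
    Holds (lift p q ≫ le) → Holds (lift q r ≫ le) → Holds (lift p r ≫ le)
  le_antisymm : ∀ {X : E} (p q : X ⟶ Q),
    Holds (lift p q ≫ le) → Holds (lift q p ≫ le) → p = q
  sup_le_iff : ∀ {X : E} (S : SubsetIn Q X) (t : X ⟶ Q),
    Holds (lift (MonoidalClosed.curry S ≫ sup) t ≫ le) ↔
      ∀ {Y : E} (y : Y ⟶ X) (q : Y ⟶ Q),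
        Holds (lift q y ≫ S) → Holds (lift q (y ≫ t) ≫ le)
  mul_sup : ∀ {X : E} (a : X ⟶ Q) (S : SubsetIn Q X),
    a * (MonoidalClosed.curry S ≫ sup) = MonoidalClosed.curry (mulLeftSet a S) ≫ sup
  sup_mul : ∀ {X : E} (S : SubsetIn Q X) (a : X ⟶ Q),
    (MonoidalClosed.curry S ≫ sup) * a = MonoidalClosed.curry (mulRightSet S a) ≫ sup

variable {Q : E} [MonObj Q] [InternalQuantale Q]

/-- Generalized elements of `Q` at stage `X`, ordered by internal validity of `p ≤ q`. -/
instance homPartialOrder (X : E) : PartialOrder (X ⟶ Q) where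
  le p q := Holds (lift p q ≫ InternalQuantale.le)
  le_refl := InternalQuantale.le_refl
  le_trans := InternalQuantale.le_trans
  le_antisymm := InternalQuantale.le_antisymm

/-- The join `⋁ S` of a subset in context. -/
def join {X : E} (S : SubsetIn Q X) : X ⟶ Q := MonoidalClosed.curry S ≫ InternalQuantale.sup

/-- The join `⋁ { F(b, x) | b : B }`, i.e. `⋁ { q | ∃ b : B, q = F(b, x) }`. -/
def joinFam {B X : E} (F : B ⊗ X ⟶ Q) : X ⟶ Q :=
  join (exF B (eqF (snd B (Q ⊗ X) ≫ fst Q X) ((B ◁ snd Q X) ≫ F)))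

theorem comp_mono {X Y : E} {p q : X ⟶ Q} (h : p ≤ q) (y : Y ⟶ X) : y ≫ p ≤ y ≫ q := by
  have : Holds (y ≫ lift p q ≫ InternalQuantale.le) := Holds.comp h y
  rw [← assoc, comp_lift] at this
  exact this

theorem join_le_iff {X : E} (S : SubsetIn Q X) (t : X ⟶ Q) :
    join S ≤ t ↔ ∀ {Y : E} (y : Y ⟶ X) (q : Y ⟶ Q), Holds (lift q y ≫ S) → q ≤ y ≫ t :=
  InternalQuantale.sup_le_iff S t

theorem comp_join {X Y : E} (y : Y ⟶ X) (S : SubsetIn Q X) :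
    y ≫ join S = join ((Q ◁ y) ≫ S) := by
  rw [join, join, MonoidalClosed.curry_natural_left, assoc]

theorem holds_le {X Y : E} (y : Y ⟶ X) (p q : X ⟶ Q) :
    Holds (y ≫ lift p q ≫ InternalQuantale.le) ↔ y ≫ p ≤ y ≫ q := by
  rw [← assoc, comp_lift]; rfl

theorem mul_join_le_iff {X Y : E} (y : Y ⟶ X) (S : SubsetIn Q X) (u t : Y ⟶ Q) :
    u * (y ≫ join S) ≤ t ↔
      ∀ {Z : E} (z : Z ⟶ Y) (q : Z ⟶ Q), Holds (lift q (z ≫ y) ≫ S) → (z ≫ u) * q ≤ z ≫ t := by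
  have e : u * (y ≫ join S) = join (mulLeftSet u ((Q ◁ y) ≫ S)) := by
    rw [comp_join]; exact InternalQuantale.mul_sup _ _
  rw [e, join_le_iff]
  simp only [mulLeftSet, holds_exF, holds_andF, holds_eqF]
  constructor
  · intro h Z z q hq
    refine h z _ ?_
    intro V v p hp
    have := hp (𝟙 _) (v ≫ q) ⟨?_, ?_⟩
    · simpa using this
    · have := Holds.comp hq v
      simpa [comp_lift_assoc] using this
    · simp [MonObj.comp_mul]
  · intro h Z z q hq
    refine hq (𝟙 _) (lift q (z ≫ t) ≫ InternalQuantale.le) ?_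
    rintro V v r ⟨h₁, h₂⟩
    rw [holds_le]
    have := h (v ≫ z) r (by simpa using h₁)
    simp [MonObj.comp_mul] at h₂
    rw [h₂]
    simpa using this

theorem mul_joinFam_le_iff {B X Y : E} (y : Y ⟶ X) (F : B ⊗ X ⟶ Q) (u t : Y ⟶ Q) :
    u * (y ≫ joinFam F) ≤ t ↔
      ∀ {Z : E} (z : Z ⟶ Y) (b : Z ⟶ B), (z ≫ u) * (lift b (z ≫ y) ≫ F) ≤ z ≫ t := by
  rw [joinFam, mul_join_le_iff]
  simp only [holds_exF, holds_eqF]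
  constructor
  · intro h Z z b
    refine h z _ ?_
    intro V v p hp
    have := hp (𝟙 _) (v ≫ b) (by simp [comp_lift_assoc])
    simpa using this
  · intro h Z z q hq
    refine hq (𝟙 _) (lift ((z ≫ u) * q) (z ≫ t) ≫ InternalQuantale.le) ?_
    intro V v b hb
    rw [holds_le]
    have := h (v ≫ z) b
    simp at hb
    rw [MonObj.comp_mul, hb]
    simpa using this

theorem mul_mono_right {X : E} (u : X ⟶ Q) {p q : X ⟶ Q} (h : p ≤ q) : u * p ≤ u * q := by
  -- `q` is the join of the elements below it
  have hq : q = join (lift (fst Q X) (snd Q X ≫ q) ≫ InternalQuantale.le) := by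
    apply le_antisymm
    · have := (join_le_iff (lift (fst Q X) (snd Q X ≫ q) ≫ InternalQuantale.le) _).1
        le_rfl (𝟙 X) q
        (by
          have : Holds (lift q q ≫ InternalQuantale.le) := le_refl q
          simpa [comp_lift_assoc] using this)
      simpa using this
    · rw [join_le_iff]
      intro Y y r hr
      rw [← assoc, comp_lift] at hr
      simpa using! hr
  have h1 := (mul_join_le_iff (𝟙 X) (lift (fst Q X) (snd Q X ≫ q) ≫ InternalQuantale.le)
    u (u * q)).1 (by rw [id_comp, ← hq]) (𝟙 X) p (by
      have : Holds (lift p q ≫ InternalQuantale.le) := h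
      simpa [comp_lift_assoc] using this)
  simpa using h1

end Quantale

/-! ### The category of `Q`-relations -/

section Relations

variable {E : Type u} [Category.{v} E] [CartesianMonoidalCategory E] [BraidedCategory E]
  [HasFiniteLimits E] [MonoidalClosed E] [HasSubobjectClassifier E]
variable {Q : E} [MonObj Q] [IsCommMonObj Q] [InternalQuantale Q]

theorem mul_mono {X : E} {p q p' q' : X ⟶ Q} (h : p ≤ q) (h' : p' ≤ q') :
    p * p' ≤ q * q' := by
  refine (mul_mono_right p h').trans ?_
  rw [mul_comm p, mul_comm q]
  exact mul_mono_right q' h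

/-- A `Q`-relation is a morphism `R : A ⊗ B ⟶ Q`; this is its value `R(a, b)` at generalized
elements `a` and `b`. -/
def ev {A B X : E} (R : A ⊗ B ⟶ Q) (a : X ⟶ A) (b : X ⟶ B) : X ⟶ Q := lift a b ≫ R

theorem comp_ev {A B X Y : E} (R : A ⊗ B ⟶ Q) (a : X ⟶ A) (b : X ⟶ B) (y : Y ⟶ X) :
    y ≫ ev R a b = ev R (y ≫ a) (y ≫ b) := by
  simp [ev, comp_lift_assoc]

theorem rel_ext {A B : E} {R S : A ⊗ B ⟶ Q}
    (h : ∀ {X : E} (a : X ⟶ A) (b : X ⟶ B), ev R a b = ev S a b) : R = S := by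
  have := h (fst A B) (snd A B)
  simpa [ev] using this

/-- Identity relation: `1_A(a₁, a₂) = ⋁ { k | a₁ = a₂ }`, where `k` is the unit of `Q`. -/
def idRel (Q : E) [MonObj Q] [InternalQuantale Q] (A : E) : A ⊗ A ⟶ Q :=
  join (andF
    (eqF (fst Q (A ⊗ A)) 1)
    (eqF (snd Q (A ⊗ A) ≫ fst A A) (snd Q (A ⊗ A) ≫ snd A A)))

/-- Composition: `(S ∘ R)(a, c) = ⋁_b R(a, b) ⊗ S(b, c)`. -/
def compRel {A B C : E} (R : A ⊗ B ⟶ Q) (S : B ⊗ C ⟶ Q) : A ⊗ C ⟶ Q :=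
  joinFam (B := B) (X := A ⊗ C)
    (ev R (snd B (A ⊗ C) ≫ fst A C) (fst B (A ⊗ C)) *
      ev S (fst B (A ⊗ C)) (snd B (A ⊗ C) ≫ snd A C))

/-- Tensor: `(R ⊗ R')((a, a'), (b, b')) = R(a, b) ⊗ R'(a', b')`. -/
def tensorRel {A B A' B' : E} (R : A ⊗ B ⟶ Q) (R' : A' ⊗ B' ⟶ Q) :
    (A ⊗ A') ⊗ (B ⊗ B') ⟶ Q :=
  ev R (fst (A ⊗ A') (B ⊗ B') ≫ fst A A') (snd (A ⊗ A') (B ⊗ B') ≫ fst B B') *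
    ev R' (fst (A ⊗ A') (B ⊗ B') ≫ snd A A') (snd (A ⊗ A') (B ⊗ B') ≫ snd B B')

/-- Graph of a morphism: `f_∘(a, b) = ⋁ { k | f(a) = b }`. -/
def graphRel (Q : E) [MonObj Q] [InternalQuantale Q] {A B : E} (f : A ⟶ B) : A ⊗ B ⟶ Q :=
  ev (idRel Q B) (fst A B ≫ f) (snd A B)

theorem ev_tensorRel {A B A' B' X : E} (R : A ⊗ B ⟶ Q) (R' : A' ⊗ B' ⟶ Q)
    (a : X ⟶ A ⊗ A') (b : X ⟶ B ⊗ B') :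
    ev (tensorRel R R') a b =
      ev R (a ≫ fst _ _) (b ≫ fst _ _) * ev R' (a ≫ snd _ _) (b ≫ snd _ _) := by
  simp [ev, tensorRel, MonObj.comp_mul]

theorem ev_graphRel {A B X : E} (f : A ⟶ B) (a : X ⟶ A) (b : X ⟶ B) :
    ev (graphRel Q f) a b = ev (idRel Q B) (a ≫ f) b := by
  simp [ev, graphRel, comp_lift_assoc]

theorem mul_idRel_le_iff {A X : E} (a b : X ⟶ A) (u t : X ⟶ Q) :
    u * ev (idRel Q A) a b ≤ t ↔
      ∀ {Z : E} (z : Z ⟶ X), z ≫ a = z ≫ b → z ≫ u ≤ z ≫ t := by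
  rw [ev, idRel, mul_join_le_iff]
  simp only [holds_andF, holds_eqF]
  constructor
  · intro h Z z hz
    have := h z 1 ⟨?_, ?_⟩
    · simpa using this
    · simp
    · simp [hz]
  · rintro h Z z q ⟨h₁, h₂⟩
    simp only [lift_fst, MonObj.comp_one] at h₁
    rw [h₁, mul_one]
    exact h z (by simpa [comp_lift_assoc] using h₂)

theorem mul_compRel_le_iff {A B C X : E} (R : A ⊗ B ⟶ Q) (S : B ⊗ C ⟶ Q)
    (a : X ⟶ A) (c : X ⟶ C) (u t : X ⟶ Q) :
    u * ev (compRel R S) a c ≤ t ↔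
      ∀ {Z : E} (z : Z ⟶ X) (b : Z ⟶ B),
        (z ≫ u) * (ev R (z ≫ a) b * ev S b (z ≫ c)) ≤ z ≫ t := by
  have e : ∀ {Z : E} (z : Z ⟶ X) (b : Z ⟶ B),
      lift b (z ≫ lift a c) ≫ (ev R (snd B (A ⊗ C) ≫ fst A C) (fst B (A ⊗ C)) *
        ev S (fst B (A ⊗ C)) (snd B (A ⊗ C) ≫ snd A C)) =
      ev R (z ≫ a) b * ev S b (z ≫ c) := by
    intro Z z b
    simp [MonObj.comp_mul, comp_ev]
  rw [ev, compRel, mul_joinFam_le_iff]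
  simp only [e]

theorem compRel_le_iff {A B C X : E} (R : A ⊗ B ⟶ Q) (S : B ⊗ C ⟶ Q)
    (a : X ⟶ A) (c : X ⟶ C) (t : X ⟶ Q) :
    ev (compRel R S) a c ≤ t ↔
      ∀ {Z : E} (z : Z ⟶ X) (b : Z ⟶ B), ev R (z ≫ a) b * ev S b (z ≫ c) ≤ z ≫ t := by
  have := mul_compRel_le_iff R S a c 1 t
  simpa [MonObj.comp_one] using this

theorem idRel_le_iff {A X : E} (a b : X ⟶ A) (t : X ⟶ Q) :
    ev (idRel Q A) a b ≤ t ↔ ∀ {Z : E} (z : Z ⟶ X), z ≫ a = z ≫ b → 1 ≤ z ≫ t := by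
  have := mul_idRel_le_iff a b 1 t
  simpa [MonObj.comp_one] using this

theorem one_le_idRel {A X : E} (a : X ⟶ A) : 1 ≤ ev (idRel Q A) a a := by
  have := (idRel_le_iff a a _).1 (le_refl (ev (idRel Q A) a a)) (𝟙 X) rfl
  simpa using this

theorem graphRel_comp_ev {A B C X : E} (f : A ⟶ B) (R : B ⊗ C ⟶ Q) (a : X ⟶ A) (c : X ⟶ C) :
    ev (compRel (graphRel Q f) R) a c = ev R (a ≫ f) c := by
  apply eq_of_forall_ge_iff
  intro t
  rw [compRel_le_iff]
  constructor
  · intro h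
    have := h (𝟙 X) (a ≫ f)
    rw [ev_graphRel, mul_comm, mul_idRel_le_iff] at this
    simpa using this (𝟙 X) (by simp)
  · intro h Z z b
    rw [ev_graphRel, mul_comm, mul_idRel_le_iff]
    intro W w hw
    rw [comp_ev, ← hw]
    simpa [comp_ev] using comp_mono h (w ≫ z)

theorem comp_graphRel_ev {A B C X : E} (e : B ≅ C) (R : A ⊗ B ⟶ Q) (a : X ⟶ A) (c : X ⟶ C) :
    ev (compRel R (graphRel Q e.hom)) a c = ev R a (c ≫ e.inv) := by
  apply eq_of_forall_ge_iff
  intro t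
  rw [compRel_le_iff]
  constructor
  · intro h
    have := h (𝟙 X) (c ≫ e.inv)
    rw [ev_graphRel, mul_idRel_le_iff] at this
    simpa using this (𝟙 X) (by simp)
  · intro h Z z b
    rw [ev_graphRel, mul_idRel_le_iff]
    intro W w hw
    have hb : w ≫ b = w ≫ z ≫ c ≫ e.inv := by
      have := hw =≫ e.inv
      simpa using this
    rw [comp_ev, hb]
    simpa [comp_ev] using comp_mono h (w ≫ z)

theorem graphRel_id (A : E) : graphRel Q (𝟙 A) = idRel Q A := by
  apply rel_ext
  intro X a b
  rw [ev_graphRel, comp_id]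

theorem id_compRel {A B : E} (R : A ⊗ B ⟶ Q) : compRel (idRel Q A) R = R := by
  apply rel_ext
  intro X a b
  rw [← graphRel_id, graphRel_comp_ev, comp_id]

theorem compRel_id {A B : E} (R : A ⊗ B ⟶ Q) : compRel R (idRel Q B) = R := by
  apply rel_ext
  intro X a b
  have := comp_graphRel_ev (Iso.refl B) R a b
  simpa [graphRel_id] using this

theorem compRel_assoc {A B C D : E} (R : A ⊗ B ⟶ Q) (S : B ⊗ C ⟶ Q) (T : C ⊗ D ⟶ Q) :
    compRel (compRel R S) T = compRel R (compRel S T) := by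
  apply rel_ext
  intro X a d
  apply eq_of_forall_ge_iff
  intro t
  rw [compRel_le_iff, compRel_le_iff]
  constructor
  · intro h Z z b
    rw [mul_compRel_le_iff]
    intro W w c
    have := h (w ≫ z) c
    rw [mul_comm, mul_compRel_le_iff] at this
    have := this (𝟙 W) (w ≫ b)
    rw [comp_ev, ← mul_assoc]
    rw [mul_comm] at this
    simpa using this
  · intro h Z z c
    rw [mul_comm, mul_compRel_le_iff]
    intro W w b
    have := h (w ≫ z) b
    rw [mul_compRel_le_iff] at this
    have := this (𝟙 W) (w ≫ c)
    rw [comp_ev, mul_comm, mul_assoc]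
    simpa using this

theorem tensorRel_id (A B : E) :
    tensorRel (idRel Q A) (idRel Q B) = idRel Q (A ⊗ B) := by
  apply rel_ext
  intro X a b
  apply eq_of_forall_ge_iff
  intro t
  rw [ev_tensorRel, mul_idRel_le_iff, idRel_le_iff]
  constructor
  · intro h Z z hz
    have h1 := h z (by rw [← assoc, hz, assoc])
    refine le_trans ?_ h1
    rw [comp_ev, ← assoc, hz, assoc]
    exact one_le_idRel _
  · intro h Z z hz
    rw [comp_ev, idRel_le_iff]
    intro W w hw
    have := h (w ≫ z) (by
      apply hom_ext
      · simpa using hw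
      · simpa using w ≫= hz)
    simpa using this

theorem tensorRel_comp {A B C A' B' C' : E} (R : A ⊗ B ⟶ Q) (S : B ⊗ C ⟶ Q)
    (R' : A' ⊗ B' ⟶ Q) (S' : B' ⊗ C' ⟶ Q) :
    compRel (tensorRel R R') (tensorRel S S') = tensorRel (compRel R S) (compRel R' S') := by
  apply rel_ext
  intro X a c
  apply eq_of_forall_ge_iff
  intro t
  rw [ev_tensorRel, compRel_le_iff, mul_compRel_le_iff]
  constructor
  · intro h Z z b'
    rw [comp_ev, mul_comm, mul_compRel_le_iff]
    intro W w b
    have := h (w ≫ z) (lift b (w ≫ b'))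
    rw [ev_tensorRel, ev_tensorRel] at this
    rw [MonObj.comp_mul, comp_ev, comp_ev, mul_comm, mul_mul_mul_comm]
    simpa using this
  · intro h Z z b
    have := h z (b ≫ snd _ _)
    rw [comp_ev, mul_comm, mul_compRel_le_iff] at this
    have := this (𝟙 Z) (b ≫ fst _ _)
    rw [ev_tensorRel, ev_tensorRel, mul_mul_mul_comm, mul_comm]
    simpa using this

theorem graphRel_comp {A B C : E} (f : A ⟶ B) (g : B ⟶ C) :
    graphRel Q (f ≫ g) = compRel (graphRel Q f) (graphRel Q g) := by
  apply rel_ext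
  intro X a c
  rw [graphRel_comp_ev, ev_graphRel, ev_graphRel, assoc]

theorem tensorRel_graph {A B A' B' : E} (f : A ⟶ B) (g : A' ⟶ B') :
    tensorRel (graphRel Q f) (graphRel Q g) = graphRel Q (f ⊗ₘ g) := by
  apply rel_ext
  intro X a b
  rw [ev_tensorRel, ev_graphRel, ev_graphRel, ev_graphRel, ← tensorRel_id, ev_tensorRel]
  simp

/-- The objects of the category of `Q`-relations are the objects of the topos. -/
structure RelObj (Q : E) where
  /-- the underlying object -/
  obj : E

/-- The category `Rel(Q)` of `Q`-relations; `R ≫ S` is `S ∘ R`. -/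
instance : Category (RelObj Q) where
  Hom A B := A.obj ⊗ B.obj ⟶ Q
  id A := idRel Q A.obj
  comp R S := compRel R S
  id_comp := id_compRel
  comp_id := compRel_id
  assoc := compRel_assoc

/-- The graph of an isomorphism is an isomorphism. -/
def graphIso {A B : E} (e : A ≅ B) : (RelObj.mk A : RelObj Q) ≅ RelObj.mk B where
  hom := graphRel Q e.hom
  inv := graphRel Q e.inv
  hom_inv_id := by
    change compRel _ _ = idRel Q A
    rw [← graphRel_comp, e.hom_inv_id, graphRel_id]
  inv_hom_id := by
    change compRel _ _ = idRel Q B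
    rw [← graphRel_comp, e.inv_hom_id, graphRel_id]

/-- The tensor product is given by the chosen products of the topos, and the coherence
isomorphisms are the graphs of those of the topos. -/
instance : MonoidalCategoryStruct (RelObj Q) where
  tensorObj A B := ⟨A.obj ⊗ B.obj⟩
  tensorUnit := ⟨𝟙_ E⟩
  tensorHom R S := tensorRel R S
  whiskerLeft A _ _ R := tensorRel (idRel Q A.obj) R
  whiskerRight R A := tensorRel R (idRel Q A.obj)
  associator A B C := graphIso (α_ A.obj B.obj C.obj)
  leftUnitor A := graphIso (λ_ A.obj)
  rightUnitor A := graphIso (ρ_ A.obj)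

instance : MonoidalCategory (RelObj Q) := MonoidalCategory.ofTensorHom
  (id_tensorHom_id := fun A B => tensorRel_id A.obj B.obj)
  (id_tensorHom := fun _ _ _ _ => rfl)
  (tensorHom_id := fun _ _ => rfl)
  (tensorHom_comp_tensorHom := fun R R' S S' => tensorRel_comp R S R' S')
  (associator_naturality := fun {A₁ A₂ A₃ B₁ B₂ B₃} R₁ R₂ R₃ => by
    change compRel (tensorRel (tensorRel R₁ R₂) R₃) (graphRel Q (α_ B₁.obj B₂.obj B₃.obj).hom) =
      compRel (graphRel Q (α_ A₁.obj A₂.obj A₃.obj).hom) (tensorRel R₁ (tensorRel R₂ R₃))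
    apply rel_ext
    intro X a b
    rw [comp_graphRel_ev, graphRel_comp_ev]
    simp [ev_tensorRel, mul_assoc])
  (leftUnitor_naturality := fun {A B} R => by
    change compRel (tensorRel (idRel Q (𝟙_ E)) R) (graphRel Q (λ_ B.obj).hom) =
      compRel (graphRel Q (λ_ A.obj).hom) R
    apply rel_ext
    intro X a b
    rw [comp_graphRel_ev, graphRel_comp_ev, ev_tensorRel]
    have h : ev (idRel Q (𝟙_ E)) (a ≫ fst _ _) ((b ≫ (λ_ B.obj).inv) ≫ fst _ _) = 1 := by
      apply le_antisymm
      · rw [idRel_le_iff]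
        intro Z z _
        rw [MonObj.comp_one]
      · rw [toUnit_unique ((b ≫ (λ_ B.obj).inv) ≫ fst _ _) (a ≫ fst _ _)]
        exact one_le_idRel _
    rw [h, one_mul, leftUnitor_hom]
    simp)
  (rightUnitor_naturality := fun {A B} R => by
    change compRel (tensorRel R (idRel Q (𝟙_ E))) (graphRel Q (ρ_ B.obj).hom) =
      compRel (graphRel Q (ρ_ A.obj).hom) R
    apply rel_ext
    intro X a b
    rw [comp_graphRel_ev, graphRel_comp_ev, ev_tensorRel]
    have h : ev (idRel Q (𝟙_ E)) (a ≫ snd _ _) ((b ≫ (ρ_ B.obj).inv) ≫ snd _ _) = 1 := by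
      apply le_antisymm
      · rw [idRel_le_iff]
        intro Z z _
        rw [MonObj.comp_one]
      · rw [toUnit_unique ((b ≫ (ρ_ B.obj).inv) ≫ snd _ _) (a ≫ snd _ _)]
        exact one_le_idRel _
    rw [h, mul_one, rightUnitor_hom]
    simp)
  (pentagon := fun A B C D => by
    change compRel (tensorRel (graphRel Q (α_ A.obj B.obj C.obj).hom) (idRel Q D.obj))
        (compRel (graphRel Q (α_ A.obj (B.obj ⊗ C.obj) D.obj).hom)
          (tensorRel (idRel Q A.obj) (graphRel Q (α_ B.obj C.obj D.obj).hom))) =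
      compRel (graphRel Q (α_ (A.obj ⊗ B.obj) C.obj D.obj).hom)
        (graphRel Q (α_ A.obj B.obj (C.obj ⊗ D.obj)).hom)
    simp only [← graphRel_id, tensorRel_graph, ← graphRel_comp]
    simp)
  (triangle := fun A B => by
    change compRel (graphRel Q (α_ A.obj (𝟙_ E) B.obj).hom)
        (tensorRel (idRel Q A.obj) (graphRel Q (λ_ B.obj).hom)) =
      tensorRel (graphRel Q (ρ_ A.obj).hom) (idRel Q B.obj)
    simp only [← graphRel_id, tensorRel_graph, ← graphRel_comp]
    simp)

end Relations

/-! ### Signatures, terms, equational logic and interpretations -/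

/-- A signature: operation symbols with finite arities. -/
structure Signature where
  /-- the operation symbols -/
  Op : Type w
  /-- the arity of an operation symbol -/
  arity : Op → ℕ

/-- Terms over the signature `S` in the variables `x_0, …, x_{n-1}`. -/
inductive Term (S : Signature.{w}) (n : ℕ) : Type w
  | var (i : Fin n) : Term S n
  | op (σ : S.Op) (ts : Fin (S.arity σ) → Term S n) : Term S n

namespace Term

variable {S T U : Signature.{w}}

/-- Simultaneous substitution. -/
def subst {m n : ℕ} (s : Fin m → Term S n) : Term S m → Term S n
  | var i => s i
  | op σ ts => op σ (fun j => (ts j).subst s)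

/-- The number of occurrences of the variable `x_i` in a term. -/
def count {n : ℕ} (i : Fin n) : Term S n → ℕ
  | var j => if j = i then 1 else 0
  | op _ ts => ∑ j, (ts j).count i

/-- Extension of an assignment of derived terms to operation symbols to all terms. -/
def translate (f : ∀ σ : S.Op, Term T (S.arity σ)) {n : ℕ} : Term S n → Term T n
  | var i => var i
  | op σ ts => (f σ).subst (fun j => (ts j).translate f)

theorem subst_var {n : ℕ} (t : Term S n) : t.subst var = t := by
  induction t with
  | var i => rfl
  | op σ ts ih => simp only [subst]; congr; funext j; exact ih j

theorem subst_subst {l m n : ℕ} (s : Fin m → Term S n) (r : Fin l → Term S m) (t : Term S l) :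
    (t.subst r).subst s = t.subst (fun i => (r i).subst s) := by
  induction t with
  | var i => rfl
  | op σ ts ih => simp only [subst]; congr; funext j; exact ih j

theorem translate_subst (f : ∀ σ : S.Op, Term T (S.arity σ)) {m n : ℕ}
    (s : Fin m → Term S n) (t : Term S m) :
    (t.subst s).translate f = (t.translate f).subst (fun i => (s i).translate f) := by
  induction t with
  | var i => rfl
  | op σ ts ih => simp only [subst, translate, subst_subst]; congr; funext j; exact ih j

theorem translate_id {n : ℕ} (t : Term S n) :
    t.translate (fun σ => op σ var) = t := by
  induction t with
  | var i => rfl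
  | op σ ts ih => simp only [translate, subst]; congr; funext j; exact ih j

theorem translate_translate (f : ∀ σ : S.Op, Term T (S.arity σ))
    (g : ∀ σ : T.Op, Term U (T.arity σ)) {n : ℕ} (t : Term S n) :
    (t.translate f).translate g = t.translate (fun σ => (f σ).translate g) := by
  induction t with
  | var i => rfl
  | op σ ts ih => simp only [translate, translate_subst]; congr; funext j; exact ih j

theorem count_subst {m n : ℕ} (s : Fin m → Term S n) (t : Term S m) (i : Fin n) :
    (t.subst s).count i = ∑ j, t.count j * (s j).count i := by
  induction t with
  | var k => simp [subst, count]
  | op σ ts ih =>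
    simp only [subst, count, ih, Finset.sum_mul]
    exact Finset.sum_comm

end Term

/-- The four disciplines for the use of variables and of truth values. -/
inductive Kind
  | linear
  | affine
  | relevant
  | cartesian

/-- A term is linear (affine, relevant) if it uses every variable of its context exactly once
(at most once, at least once), and cartesian without restriction. -/
def Term.HasKind {S : Signature.{w}} {n : ℕ} (t : Term S n) : Kind → Prop
  | .linear => ∀ i, t.count i = 1
  | .affine => ∀ i, t.count i ≤ 1
  | .relevant => ∀ i, 1 ≤ t.count i
  | .cartesian => True

theorem Term.HasKind.op_var {S : Signature.{w}} (κ : Kind) (σ : S.Op) :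
    (Term.op σ Term.var : Term S (S.arity σ)).HasKind κ := by
  cases κ <;> simp [HasKind, count]

theorem Term.HasKind.translate {S T : Signature.{w}} {κ : Kind}
    {f : ∀ σ : S.Op, Term T (S.arity σ)} (hf : ∀ σ, (f σ).HasKind κ) {n : ℕ}
    {t : Term S n} (ht : t.HasKind κ) : (t.translate f).HasKind κ := by
  cases κ with
  | linear =>
    have key : ∀ (t : Term S n) i, (t.translate f).count i = t.count i := by
      intro t i
      induction t with
      | var k => rfl
      | op σ ts ih =>
        have h := hf σ
        simp only [HasKind] at h
        simp [Term.translate, count_subst, count, ih, h]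
    intro i
    rw [key]; exact ht i
  | affine =>
    have key : ∀ (t : Term S n) i, (t.translate f).count i ≤ t.count i := by
      intro t i
      induction t with
      | var k => rfl
      | op σ ts ih =>
        simp only [Term.translate, count_subst, count]
        refine Finset.sum_le_sum fun j _ => ?_
        calc _ ≤ 1 * (ts j).count i := Nat.mul_le_mul (hf σ j) (ih j)
          _ = _ := one_mul _
    intro i
    exact (key t i).trans (ht i)
  | relevant =>
    have key : ∀ (t : Term S n) i, t.count i ≤ (t.translate f).count i := by
      intro t i
      induction t with
      | var k => rfl
      | op σ ts ih =>
        simp only [Term.translate, count_subst, count]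
        refine Finset.sum_le_sum fun j _ => ?_
        calc _ = 1 * (ts j).count i := (one_mul _).symm
          _ ≤ _ := Nat.mul_le_mul (hf σ j) (ih j)
    intro i
    exact (ht i).trans (key t i)
  | cartesian => trivial

/-- A signature together with a set of equations between terms in finitely many variables. -/
structure Presentation extends Signature.{w} where
  /-- the equations -/
  eqs : ∀ {n : ℕ}, Term toSignature n → Term toSignature n → Prop

/-- Provability in equational logic from the equations of `P`. -/
inductive Provable (P : Presentation.{w}) :
    ∀ {n : ℕ}, Term P.toSignature n → Term P.toSignature n → Prop
  | ax {n m : ℕ} {s t : Term P.toSignature n} (h : P.eqs s t)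
      (r : Fin n → Term P.toSignature m) : Provable P (s.subst r) (t.subst r)
  | refl {n : ℕ} (t : Term P.toSignature n) : Provable P t t
  | symm {n : ℕ} {s t : Term P.toSignature n} : Provable P s t → Provable P t s
  | trans {n : ℕ} {s t r : Term P.toSignature n} :
      Provable P s t → Provable P t r → Provable P s r
  | congr {n : ℕ} (σ : P.Op) {ss ts : Fin (P.arity σ) → Term P.toSignature n} :
      (∀ j, Provable P (ss j) (ts j)) → Provable P (.op σ ss) (.op σ ts)

theorem Provable.subst {P : Presentation.{w}} {n m : ℕ} {s t : Term P.toSignature n}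
    (h : Provable P s t) (r : Fin n → Term P.toSignature m) :
    Provable P (s.subst r) (t.subst r) := by
  induction h with
  | ax h q => rw [Term.subst_subst, Term.subst_subst]; exact .ax h _
  | refl t => exact .refl _
  | symm _ ih => exact (ih r).symm
  | trans _ _ ih₁ ih₂ => exact (ih₁ r).trans (ih₂ r)
  | congr σ _ ih => exact .congr σ fun j => ih j r

theorem Provable.subst_congr {P : Presentation.{w}} {n m : ℕ} (t : Term P.toSignature n)
    {r q : Fin n → Term P.toSignature m} (h : ∀ i, Provable P (r i) (q i)) :
    Provable P (t.subst r) (t.subst q) := by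
  induction t with
  | var i => exact h i
  | op σ ts ih => exact .congr σ ih

/-- An interpretation of kind `κ`: operation symbols are sent to derived terms of the same
arity, all of kind `κ`, such that the translated equations are provable. -/
@[ext]
structure Interpretation (κ : Kind) (P R : Presentation.{w}) where
  /-- the derived term assigned to an operation symbol -/
  term : ∀ σ : P.Op, Term R.toSignature (P.arity σ)
  hasKind : ∀ σ, (term σ).HasKind κ
  provable : ∀ {n : ℕ} {s t : Term P.toSignature n}, P.eqs s t →
    Provable R (s.translate term) (t.translate term)

theorem Interpretation.translate_provable {κ : Kind} {P R : Presentation.{w}}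
    (i : Interpretation κ P R) {n : ℕ} {s t : Term P.toSignature n} (h : Provable P s t) :
    Provable R (s.translate i.term) (t.translate i.term) := by
  induction h with
  | ax h r => rw [Term.translate_subst, Term.translate_subst]; exact (i.provable h).subst _
  | refl t => exact .refl _
  | symm _ ih => exact ih.symm
  | trans _ _ ih₁ ih₂ => exact ih₁.trans ih₂
  | congr σ _ ih => exact Provable.subst_congr _ ih

/-- The category of signatures with equations and interpretations of kind `κ`. -/
structure SigCat (κ : Kind) where
  /-- the underlying signature with equations -/
  pres : Presentation.{w}

instance (κ : Kind) : Category (SigCat.{w} κ) where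
  Hom P R := Interpretation κ P.pres R.pres
  id P :=
    { term := fun σ => .op σ .var
      hasKind := fun σ => Term.HasKind.op_var κ σ
      provable := fun {n s t} h => by
        rw [Term.translate_id, Term.translate_id]
        have := Provable.ax h (Term.var (S := P.pres.toSignature))
        rwa [Term.subst_var, Term.subst_var] at this }
  comp i j :=
    { term := fun σ => (i.term σ).translate j.term
      hasKind := fun σ => Term.HasKind.translate j.hasKind (i.hasKind σ)
      provable := fun h => by
        rw [← Term.translate_translate, ← Term.translate_translate]
        exact j.translate_provable (i.provable h) }
  id_comp i := by
    apply Interpretation.ext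
    funext σ
    exact Term.subst_var _
  comp_id i := by
    apply Interpretation.ext
    funext σ
    exact Term.translate_id _
  assoc i j k := by
    apply Interpretation.ext
    funext σ
    exact Term.translate_translate _ _ _

/-! ### Algebras in a topos -/

section Algebras

variable {E : Type u} [Category.{v} E] [HasFiniteLimits E]

/-- The `n`-th power of an object. -/
abbrev power (A : E) (n : ℕ) : E := ∏ᶜ fun _ : Fin n => A

/-- A structure for a signature in `E`: an object with a morphism `Aⁿ ⟶ A` for every `n`-ary
operation symbol. -/
structure SigStructure (E : Type u) [Category.{v} E] [HasFiniteLimits E]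
    (S : Signature.{w}) where
  /-- the underlying object -/
  carrier : E
  /-- the interpretation of the operation symbols -/
  op : ∀ σ : S.Op, power carrier (S.arity σ) ⟶ carrier

namespace SigStructure

/-- The derived operation of a term. -/
def eval {S : Signature.{w}} (A : SigStructure E S) {n : ℕ} :
    Term S n → (power A.carrier n ⟶ A.carrier)
  | .var i => Pi.π (fun _ : Fin n => A.carrier) i
  | .op σ ts => Pi.lift (fun j => A.eval (ts j)) ≫ A.op σ

/-- The structure whose operations are the derived operations of given terms. -/
def reduct {S T : Signature.{w}} (f : ∀ σ : S.Op, Term T (S.arity σ)) (A : SigStructure E T) :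
    SigStructure E S where
  carrier := A.carrier
  op σ := A.eval (f σ)

/-- The value `σ(a_1, …, a_n)` at generalized elements. -/
def opApp {S : Signature.{w}} (A : SigStructure E S) (σ : S.Op) {X : E}
    (a : Fin (S.arity σ) → (X ⟶ A.carrier)) : X ⟶ A.carrier := Pi.lift a ≫ A.op σ

/-- The value `t(a_0, …, a_{n-1})` at generalized elements. -/
def app {S : Signature.{w}} (A : SigStructure E S) {n : ℕ} (t : Term S n) {X : E}
    (a : Fin n → (X ⟶ A.carrier)) : X ⟶ A.carrier := Pi.lift a ≫ A.eval t

variable [CartesianMonoidalCategory E]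

/-- Product structure with componentwise operations, on the chosen product. -/
abbrev prod {S : Signature.{w}} (A B : SigStructure E S) : SigStructure E S where
  carrier := A.carrier ⊗ B.carrier
  op σ := lift
    (Pi.lift (fun j => Pi.π (fun _ => A.carrier ⊗ B.carrier) j ≫ fst _ _) ≫ A.op σ)
    (Pi.lift (fun j => Pi.π (fun _ => A.carrier ⊗ B.carrier) j ≫ snd _ _) ≫ B.op σ)

/-- The structure on the chosen terminal object. -/
abbrev terminal (E : Type u) [Category.{v} E] [HasFiniteLimits E] [CartesianMonoidalCategory E]
    (S : Signature.{w}) : SigStructure E S where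
  carrier := 𝟙_ E
  op _ := toUnit _

theorem opApp_prod {S : Signature.{w}} (A B : SigStructure E S) (σ : S.Op) {X : E}
    (a : Fin (S.arity σ) → (X ⟶ A.carrier ⊗ B.carrier)) :
    (A.prod B).opApp σ a =
      lift (A.opApp σ fun j => a j ≫ fst _ _) (B.opApp σ fun j => a j ≫ snd _ _) := by
  have e₁ : Pi.lift a ≫ Pi.lift (fun j => Pi.π (fun _ => A.carrier ⊗ B.carrier) j ≫ fst _ _) =
      Pi.lift (fun j => a j ≫ fst _ _) := by
    apply Pi.hom_ext; intro j; simp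
  have e₂ : Pi.lift a ≫ Pi.lift (fun j => Pi.π (fun _ => A.carrier ⊗ B.carrier) j ≫ snd _ _) =
      Pi.lift (fun j => a j ≫ snd _ _) := by
    apply Pi.hom_ext; intro j; simp
  unfold opApp
  rw [← e₁, ← e₂, assoc, assoc]
  exact comp_lift _ _ _

theorem prod_eval {S : Signature.{w}} (A B : SigStructure E S) {n : ℕ} (t : Term S n) :
    (A.prod B).eval t = lift
      (Pi.lift (fun j => Pi.π (fun _ => A.carrier ⊗ B.carrier) j ≫ fst _ _) ≫ A.eval t)
      (Pi.lift (fun j => Pi.π (fun _ => A.carrier ⊗ B.carrier) j ≫ snd _ _) ≫ B.eval t) := by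
  induction t with
  | var i => apply hom_ext <;> simp [eval, prod]
  | op σ ts ih =>
    have h := opApp_prod A B σ (fun j => (A.prod B).eval (ts j))
    refine h.trans ?_
    simp only [ih, eval, opApp]
    congr 1 <;> rw [← assoc] <;> congr 1 <;> apply Pi.hom_ext <;> intro j
    · rw [Pi.lift_π, assoc, Pi.lift_π]
      exact lift_fst _ _
    · rw [Pi.lift_π, assoc, Pi.lift_π]
      exact lift_snd _ _

/-- A homomorphism of structures. -/
def IsHom {S : Signature.{w}} (A B : SigStructure E S) (f : A.carrier ⟶ B.carrier) : Prop :=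
  ∀ (σ : S.Op) {X : E} (a : Fin (S.arity σ) → (X ⟶ A.carrier)),
    A.opApp σ a ≫ f = B.opApp σ fun j => a j ≫ f

theorem comp_opApp {S : Signature.{w}} (A : SigStructure E S) (σ : S.Op) {X Y : E}
    (y : Y ⟶ X) (a : Fin (S.arity σ) → (X ⟶ A.carrier)) :
    y ≫ A.opApp σ a = A.opApp σ fun j => y ≫ a j := by
  unfold opApp
  rw [← assoc]
  congr 1
  apply Pi.hom_ext
  intro j
  simp

theorem isHom_associator {S : Signature.{w}} (A B C : SigStructure E S) :
    ((A.prod B).prod C).IsHom (A.prod (B.prod C)) (α_ A.carrier B.carrier C.carrier).hom := by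
  intro σ X a
  have h₁ := opApp_prod (A.prod B) C σ a
  have h₂ := opApp_prod A B σ (fun j => a j ≫ fst (A.carrier ⊗ B.carrier) C.carrier)
  have h₃ := opApp_prod A (B.prod C) σ
    (fun j => a j ≫ (α_ A.carrier B.carrier C.carrier).hom)
  have h₄ := opApp_prod B C σ
    (fun j => (a j ≫ (α_ A.carrier B.carrier C.carrier).hom) ≫
      snd A.carrier (B.carrier ⊗ C.carrier))
  refine (congrArg (· ≫ (α_ A.carrier B.carrier C.carrier).hom)
    (h₁.trans (congrArg (lift · _) h₂))).trans
    (Eq.trans ?_ (h₃.trans (congrArg (lift _ ·) h₄)).symm)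
  simp

theorem isHom_leftUnitor {S : Signature.{w}} (A : SigStructure E S) :
    ((terminal E S).prod A).IsHom A (λ_ A.carrier).hom := by
  intro σ X a
  refine (congrArg (· ≫ (λ_ A.carrier).hom) (opApp_prod (terminal E S) A σ a)).trans ?_
  rw [leftUnitor_hom]
  exact lift_snd _ _

theorem isHom_rightUnitor {S : Signature.{w}} (A : SigStructure E S) :
    (A.prod (terminal E S)).IsHom A (ρ_ A.carrier).hom := by
  intro σ X a
  refine (congrArg (· ≫ (ρ_ A.carrier).hom) (opApp_prod A (terminal E S) σ a)).trans ?_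
  rw [rightUnitor_hom]
  exact lift_fst _ _

end SigStructure

/-- A `(Σ, E)`-algebra in the topos: a structure satisfying the equations. -/
structure Algebra (E : Type u) [Category.{v} E] [HasFiniteLimits E]
    (P : Presentation.{w}) extends SigStructure E P.toSignature where
  sat : ∀ {n : ℕ} {s t : Term P.toSignature n}, P.eqs s t →
    toSigStructure.eval s = toSigStructure.eval t

variable [CartesianMonoidalCategory E]

/-- The product of algebras. -/
abbrev Algebra.prod {P : Presentation.{w}} (A B : Algebra E P) : Algebra E P where
  toSigStructure := A.toSigStructure.prod B.toSigStructure
  sat h := by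
    rw [SigStructure.prod_eval, SigStructure.prod_eval, A.sat h, B.sat h]

/-- The terminal algebra. -/
abbrev Algebra.terminal (E : Type u) [Category.{v} E] [HasFiniteLimits E]
    [CartesianMonoidalCategory E] (P : Presentation.{w}) : Algebra E P where
  toSigStructure := SigStructure.terminal E P.toSignature
  sat _ := toUnit_unique _ _

end Algebras

/-! ### Algebraic `Q`-relations -/

section AlgebraicRelations

variable {E : Type u} [Category.{v} E] [CartesianMonoidalCategory E] [BraidedCategory E]
  [HasFiniteLimits E] [MonoidalClosed E] [HasSubobjectClassifier E]
variable {Q : E} [MonObj Q] [IsCommMonObj Q] [InternalQuantale Q]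

/-- A `Q`-relation between structures is algebraic if internally
`R(a₁, b₁) ⊗ ⋯ ⊗ R(aₙ, bₙ) ≤ R(σ(a₁, …, aₙ), σ(b₁, …, bₙ))` for every operation symbol. -/
def IsAlgebraic {S : Signature.{w}} (A B : SigStructure E S)
    (R : A.carrier ⊗ B.carrier ⟶ Q) : Prop :=
  ∀ (σ : S.Op) {X : E} (a : Fin (S.arity σ) → (X ⟶ A.carrier))
    (b : Fin (S.arity σ) → (X ⟶ B.carrier)),
    ∏ j, ev R (a j) (b j) ≤ ev R (A.opApp σ a) (B.opApp σ b)

/-- `R` is affine if internally `R(a₁, b₁) ⊗ R(a₂, b₂) ≤ R(a₁, b₁)`. -/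
def IsAffine {A B : E} (R : A ⊗ B ⟶ Q) : Prop :=
  ∀ {X : E} (a₁ a₂ : X ⟶ A) (b₁ b₂ : X ⟶ B), ev R a₁ b₁ * ev R a₂ b₂ ≤ ev R a₁ b₁

/-- `R` is relevant if internally `R(a, b) ≤ R(a, b) ⊗ R(a, b)`. -/
def IsRelevant {A B : E} (R : A ⊗ B ⟶ Q) : Prop :=
  ∀ {X : E} (a : X ⟶ A) (b : X ⟶ B), ev R a b ≤ ev R a b * ev R a b

/-- Linear relations are arbitrary; cartesian relations are both affine and relevant. -/
def RelHasKind {A B : E} (R : A ⊗ B ⟶ Q) : Kind → Prop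
  | .linear => True
  | .affine => IsAffine R
  | .relevant => IsRelevant R
  | .cartesian => IsAffine R ∧ IsRelevant R

theorem RelHasKind.of_closure {A B C D : E} {R : A ⊗ B ⟶ Q} {S : C ⊗ D ⟶ Q}
    (ha : IsAffine R → IsAffine S) (hr : IsRelevant R → IsRelevant S) {κ : Kind}
    (h : RelHasKind R κ) : RelHasKind S κ := by
  cases κ with
  | linear => trivial
  | affine => exact ha h
  | relevant => exact hr h
  | cartesian => exact ⟨ha h.1, hr h.2⟩

theorem RelHasKind.of_closure₂ {A B C D F G : E} {R : A ⊗ B ⟶ Q} {R' : C ⊗ D ⟶ Q}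
    {S : F ⊗ G ⟶ Q} (ha : IsAffine R → IsAffine R' → IsAffine S)
    (hr : IsRelevant R → IsRelevant R' → IsRelevant S) {κ : Kind}
    (h : RelHasKind R κ) (h' : RelHasKind R' κ) : RelHasKind S κ := by
  cases κ with
  | linear => trivial
  | affine => exact ha h h'
  | relevant => exact hr h h'
  | cartesian => exact ⟨ha h.1 h'.1, hr h.2 h'.2⟩

theorem graphRel_hasKind {A B : E} (f : A ⟶ B) (κ : Kind) :
    RelHasKind (graphRel Q f) κ := by
  have ha : IsAffine (graphRel Q f) := by
    intro X a₁ a₂ b₁ b₂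
    simp only [ev_graphRel]
    rw [mul_idRel_le_iff]
    exact fun z _ => le_rfl
  have hr : IsRelevant (graphRel Q f) := by
    intro X a b
    simp only [ev_graphRel]
    rw [idRel_le_iff]
    intro Z z hz
    rw [MonObj.comp_mul, comp_ev, hz]
    calc (1 : Z ⟶ Q) = 1 * 1 := (one_mul 1).symm
      _ ≤ _ := mul_mono (one_le_idRel _) (one_le_idRel _)
  cases κ with
  | linear => trivial
  | affine => exact @ha
  | relevant => exact @hr
  | cartesian => exact ⟨@ha, @hr⟩

theorem compRel_hasKind {A B C : E} {R : A ⊗ B ⟶ Q} {S : B ⊗ C ⟶ Q} {κ : Kind}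
    (hR : RelHasKind R κ) (hS : RelHasKind S κ) : RelHasKind (compRel R S) κ := by
  have le_comp : ∀ {X : E} (a : X ⟶ A) (b : X ⟶ B) (c : X ⟶ C),
      ev R a b * ev S b c ≤ ev (compRel R S) a c := by
    intro X a b c
    have := (compRel_le_iff R S a c _).1 le_rfl (𝟙 X) b
    simpa using this
  refine RelHasKind.of_closure₂ ?_ ?_ hR hS
  · intro h₁ h₂ X a₁ a₂ c₁ c₂
    rw [mul_compRel_le_iff]
    intro Z z b₂
    rw [comp_ev, mul_comm, mul_compRel_le_iff]
    intro W w b₁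
    rw [MonObj.comp_mul, comp_ev, comp_ev, comp_ev, mul_comm, mul_mul_mul_comm]
    exact (mul_mono (h₁ _ _ _ _) (h₂ _ _ _ _)).trans (le_comp _ _ _)
  · intro h₁ h₂ X a c
    rw [compRel_le_iff]
    intro Z z b
    refine (mul_mono (h₁ _ _) (h₂ _ _)).trans ?_
    rw [mul_mul_mul_comm, MonObj.comp_mul, comp_ev]
    exact mul_mono (le_comp _ _ _) (le_comp _ _ _)

theorem tensorRel_hasKind {A B A' B' : E} {R : A ⊗ B ⟶ Q} {R' : A' ⊗ B' ⟶ Q} {κ : Kind}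
    (hR : RelHasKind R κ) (hR' : RelHasKind R' κ) : RelHasKind (tensorRel R R') κ := by
  refine RelHasKind.of_closure₂ ?_ ?_ hR hR'
  · intro h h' X a₁ a₂ b₁ b₂
    simp only [ev_tensorRel]
    rw [mul_mul_mul_comm]
    exact mul_mono (h _ _ _ _) (h' _ _ _ _)
  · intro h h' X a b
    simp only [ev_tensorRel]
    rw [mul_mul_mul_comm]
    exact mul_mono (h _ _) (h' _ _)

theorem prod_mono {n : ℕ} {X : E} {p q : Fin n → (X ⟶ Q)} (h : ∀ j, p j ≤ q j) :
    ∏ j, p j ≤ ∏ j, q j := by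
  induction n with
  | zero => simp
  | succ n ih =>
    rw [Fin.prod_univ_succ, Fin.prod_univ_succ]
    exact mul_mono (h 0) (ih fun j => h j.succ)

theorem comp_prod {n : ℕ} {X Y : E} (y : Y ⟶ X) (p : Fin n → (X ⟶ Q)) :
    y ≫ ∏ j, p j = ∏ j, y ≫ p j := by
  induction n with
  | zero => simp [MonObj.comp_one]
  | succ n ih => rw [Fin.prod_univ_succ, Fin.prod_univ_succ, MonObj.comp_mul, ih]

theorem mul_prod_idRel_le_iff {n : ℕ} {A X : E} (a b : Fin n → (X ⟶ A)) (u t : X ⟶ Q) :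
    u * ∏ j, ev (idRel Q A) (a j) (b j) ≤ t ↔
      ∀ {Z : E} (z : Z ⟶ X), (∀ j, z ≫ a j = z ≫ b j) → z ≫ u ≤ z ≫ t := by
  induction n generalizing u with
  | zero =>
    simp only [Finset.univ_eq_empty, Finset.prod_empty, mul_one]
    exact ⟨fun h Z z _ => comp_mono h z, fun h => by simpa using h (𝟙 X) (fun j => j.elim0)⟩
  | succ n ih =>
    rw [Fin.prod_univ_succ, ← mul_assoc, ih (fun j => a j.succ) (fun j => b j.succ)]
    constructor
    · intro h Z z hz
      refine le_trans ?_ (h z fun j => hz j.succ)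
      rw [MonObj.comp_mul, comp_ev, hz 0]
      calc z ≫ u = (z ≫ u) * 1 := (mul_one _).symm
        _ ≤ _ := mul_mono le_rfl (one_le_idRel _)
    · intro h Z z hz
      rw [MonObj.comp_mul, comp_ev, mul_idRel_le_iff]
      intro W w hw
      have := h (w ≫ z) (Fin.cases (by simpa using hw) fun j => by
        have := w ≫= hz j
        simpa using this)
      simpa using this

theorem mul_prod_compRel_le_iff {n : ℕ} {A B C X : E} (R : A ⊗ B ⟶ Q) (S : B ⊗ C ⟶ Q)
    (a : Fin n → (X ⟶ A)) (c : Fin n → (X ⟶ C)) (u t : X ⟶ Q) :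
    u * ∏ j, ev (compRel R S) (a j) (c j) ≤ t ↔
      ∀ {Z : E} (z : Z ⟶ X) (b : Fin n → (Z ⟶ B)),
        (z ≫ u) * ∏ j, (ev R (z ≫ a j) (b j) * ev S (b j) (z ≫ c j)) ≤ z ≫ t := by
  induction n generalizing X with
  | zero =>
    simp only [Finset.univ_eq_empty, Finset.prod_empty, mul_one]
    exact ⟨fun h Z z _ => comp_mono h z, fun h => by simpa using h (𝟙 X) (fun j => j.elim0)⟩
  | succ n ih =>
    rw [Fin.prod_univ_succ, ← mul_assoc, ih (fun j => a j.succ) (fun j => c j.succ)]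
    constructor
    · intro h Z z b
      rw [Fin.prod_univ_succ, ← mul_assoc]
      refine le_trans (mul_mono ?_ le_rfl) (h z fun j => b j.succ)
      rw [MonObj.comp_mul, comp_ev]
      have := (mul_compRel_le_iff R S (z ≫ a 0) (z ≫ c 0) (z ≫ u) _).1 le_rfl (𝟙 Z) (b 0)
      simpa using this
    · intro h Z z b
      rw [MonObj.comp_mul, comp_ev, mul_right_comm, mul_compRel_le_iff]
      intro W w b₀
      have := h (w ≫ z) (Fin.cons b₀ fun j => w ≫ b j)
      rw [Fin.prod_univ_succ] at this
      rw [MonObj.comp_mul, comp_prod, mul_right_comm, mul_assoc]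
      simpa [MonObj.comp_mul, comp_ev] using this

theorem graphRel_isAlgebraic {S : Signature.{w}} {A B : SigStructure E S}
    {f : A.carrier ⟶ B.carrier} (hf : A.IsHom B f) :
    IsAlgebraic A B (graphRel Q f) := by
  intro σ X a b
  simp only [ev_graphRel]
  have := mul_prod_idRel_le_iff (Q := Q) (fun j => a j ≫ f) b 1
    (ev (idRel Q B.carrier) (A.opApp σ a ≫ f) (B.opApp σ b))
  rw [one_mul] at this
  rw [this]
  intro Z z hz
  rw [comp_ev, MonObj.comp_one, hf σ a, SigStructure.comp_opApp, SigStructure.comp_opApp]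
  simp only [hz]
  exact one_le_idRel _

theorem compRel_isAlgebraic {S : Signature.{w}} {A B C : SigStructure E S}
    {R : A.carrier ⊗ B.carrier ⟶ Q} {T : B.carrier ⊗ C.carrier ⟶ Q}
    (hR : IsAlgebraic A B R) (hT : IsAlgebraic B C T) :
    IsAlgebraic A C (compRel R T) := by
  intro σ X a c
  have := mul_prod_compRel_le_iff R T a c 1
    (ev (compRel R T) (A.opApp σ a) (C.opApp σ c))
  rw [one_mul] at this
  rw [this]
  intro Z z b
  rw [MonObj.comp_one, one_mul, Finset.prod_mul_distrib, comp_ev, SigStructure.comp_opApp,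
    SigStructure.comp_opApp]
  refine (mul_mono (hR σ _ _) (hT σ _ _)).trans ?_
  have := (compRel_le_iff R T (A.opApp σ fun j => z ≫ a j) (C.opApp σ fun j => z ≫ c j) _).1
    le_rfl (𝟙 Z) (B.opApp σ b)
  simpa using this

theorem tensorRel_isAlgebraic {S : Signature.{w}} {A B A' B' : SigStructure E S}
    {R : A.carrier ⊗ B.carrier ⟶ Q} {R' : A'.carrier ⊗ B'.carrier ⟶ Q}
    (hR : IsAlgebraic A B R) (hR' : IsAlgebraic A' B' R') :
    IsAlgebraic (A.prod A') (B.prod B') (tensorRel R R') := by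
  intro σ X a b
  have h : ∀ j, ev (tensorRel R R') (a j) (b j) =
      ev R (a j ≫ fst _ _) (b j ≫ fst _ _) * ev R' (a j ≫ snd _ _) (b j ≫ snd _ _) :=
    fun j => ev_tensorRel R R' (a j) (b j)
  refine le_of_eq_of_le ((Finset.prod_congr rfl fun j _ => h j).trans
    Finset.prod_mul_distrib) ?_
  refine le_of_le_of_eq (mul_mono (hR σ _ _) (hR' σ _ _)) ?_
  refine Eq.symm ((congrArg₂ (fun x y => ev (tensorRel R R') x y)
    (SigStructure.opApp_prod A A' σ a) (SigStructure.opApp_prod B B' σ b)).trans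
    ((ev_tensorRel R R' _ _).trans ?_))
  simp only [lift_fst, lift_snd]

/-- The objects of the category of algebraic `Q`-relations of kind `κ`: the algebras. -/
structure AlgRel (Q : E) (κ : Kind) (P : Presentation.{w}) where
  /-- the underlying algebra -/
  alg : Algebra E P

/-- A morphism is an algebraic `Q`-relation of kind `κ` between the algebras. -/
@[ext]
structure AlgRel.Hom {κ : Kind} {P : Presentation.{w}} (A B : AlgRel Q κ P) where
  /-- the underlying `Q`-relation -/
  rel : A.alg.carrier ⊗ B.alg.carrier ⟶ Q
  isAlgebraic : IsAlgebraic A.alg.toSigStructure B.alg.toSigStructure rel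
  hasKind : RelHasKind rel κ

namespace AlgRel

variable {κ : Kind} {P : Presentation.{w}}

/-- The graph of a homomorphism of algebras. -/
def graph {A B : AlgRel Q κ P} (f : A.alg.carrier ⟶ B.alg.carrier)
    (hf : A.alg.IsHom B.alg.toSigStructure f) : Hom A B where
  rel := graphRel Q f
  isAlgebraic := graphRel_isAlgebraic hf
  hasKind := graphRel_hasKind f κ

theorem isHom_id (A : SigStructure E P.toSignature) : A.IsHom A (𝟙 _) := by
  intro σ X a
  simp only [comp_id]

/-- The category of algebraic `Q`-relations of kind `κ` over the signature with equations `P`,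
with identities and composition those of `Q`-relations. -/
instance : Category (AlgRel Q κ P) where
  Hom := Hom
  id A :=
    { rel := idRel Q A.alg.carrier
      isAlgebraic := graphRel_id (Q := Q) A.alg.carrier ▸ graphRel_isAlgebraic (isHom_id _)
      hasKind := graphRel_id (Q := Q) A.alg.carrier ▸ graphRel_hasKind _ κ }
  comp R S :=
    { rel := compRel R.rel S.rel
      isAlgebraic := compRel_isAlgebraic R.isAlgebraic S.isAlgebraic
      hasKind := compRel_hasKind R.hasKind S.hasKind }
  id_comp R := Hom.ext (id_compRel R.rel)
  comp_id R := Hom.ext (compRel_id R.rel)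
  assoc R S T := Hom.ext (compRel_assoc R.rel S.rel T.rel)

/-- The forgetful functor to `Q`-relations: underlying objects, and the same relations. -/
def forget (Q : E) [MonObj Q] [IsCommMonObj Q] [InternalQuantale Q] (κ : Kind)
    (P : Presentation.{w}) : AlgRel Q κ P ⥤ RelObj Q where
  obj A := ⟨A.alg.carrier⟩
  map R := R.rel

instance : (forget Q κ P).Faithful where
  map_injective h := Hom.ext h

/-- The graph of an isomorphism of algebras. -/
def graphIso {A B : AlgRel Q κ P} (e : A.alg.carrier ≅ B.alg.carrier)
    (h : A.alg.IsHom B.alg.toSigStructure e.hom) : A ≅ B where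
  hom := graph e.hom h
  inv := graph e.inv (fun σ X a => by
    rw [← cancel_mono e.hom, assoc, e.inv_hom_id, comp_id, h]
    simp)
  hom_inv_id := Hom.ext (QRel.graphIso (Q := Q) e).hom_inv_id
  inv_hom_id := Hom.ext (QRel.graphIso (Q := Q) e).inv_hom_id

/-- The tensor product is the product of algebras and the unit the terminal algebra; tensor
products of morphisms and coherence isomorphisms are those of `Q`-relations. -/
instance : MonoidalCategoryStruct (AlgRel Q κ P) where
  tensorObj A B := ⟨A.alg.prod B.alg⟩
  tensorUnit := ⟨Algebra.terminal E P⟩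
  tensorHom R S :=
    { rel := tensorRel R.rel S.rel
      isAlgebraic := tensorRel_isAlgebraic R.isAlgebraic S.isAlgebraic
      hasKind := tensorRel_hasKind R.hasKind S.hasKind }
  whiskerLeft A _ _ R :=
    { rel := tensorRel (idRel Q A.alg.carrier) R.rel
      isAlgebraic := tensorRel_isAlgebraic (Hom.isAlgebraic (𝟙 A)) R.isAlgebraic
      hasKind := tensorRel_hasKind (Hom.hasKind (𝟙 A)) R.hasKind }
  whiskerRight R A :=
    { rel := tensorRel R.rel (idRel Q A.alg.carrier)
      isAlgebraic := tensorRel_isAlgebraic R.isAlgebraic (Hom.isAlgebraic (𝟙 A))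
      hasKind := tensorRel_hasKind R.hasKind (Hom.hasKind (𝟙 A)) }
  associator A B C := graphIso (α_ A.alg.carrier B.alg.carrier C.alg.carrier) 
    (SigStructure.isHom_associator _ _ _)
  leftUnitor A := graphIso (λ_ A.alg.carrier) (SigStructure.isHom_leftUnitor _)
  rightUnitor A := graphIso (ρ_ A.alg.carrier) (SigStructure.isHom_rightUnitor _)

instance : MonoidalCategory (AlgRel Q κ P) := MonoidalCategory.ofTensorHom
  (id_tensorHom_id := fun A B => Hom.ext (tensorRel_id A.alg.carrier B.alg.carrier))
  (id_tensorHom := fun _ _ _ _ => rfl)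
  (tensorHom_id := fun _ _ => rfl)
  (tensorHom_comp_tensorHom := fun R R' S S' =>
    Hom.ext (tensorRel_comp R.rel S.rel R'.rel S'.rel))
  (associator_naturality := fun R₁ R₂ R₃ => Hom.ext (MonoidalCategory.associator_naturality
    ((forget Q κ P).map R₁) ((forget Q κ P).map R₂) ((forget Q κ P).map R₃)))
  (leftUnitor_naturality := fun R => Hom.ext
    (MonoidalCategory.leftUnitor_naturality ((forget Q κ P).map R)))
  (rightUnitor_naturality := fun R => Hom.ext
    (MonoidalCategory.rightUnitor_naturality ((forget Q κ P).map R)))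
  (pentagon := fun A B C D => Hom.ext (MonoidalCategory.pentagon ((forget Q κ P).obj A)
    ((forget Q κ P).obj B) ((forget Q κ P).obj C) ((forget Q κ P).obj D)))
  (triangle := fun A B => Hom.ext
    (MonoidalCategory.triangle ((forget Q κ P).obj A) ((forget Q κ P).obj B)))

end AlgRel

end AlgebraicRelations

/-- A strict monoidal functor: the unit object and tensor products of objects are preserved on
the nose, and `F` is a monoidal functor whose structure morphisms are the identities. -/
def IsStrictMonoidal {C : Type*} [Category* C] [MonoidalCategory C] {D : Type*} [Category* D]
    [MonoidalCategory D] (F : C ⥤ D) : Prop :=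
  ∃ (h₀ : 𝟙_ D = F.obj (𝟙_ C)) (h₂ : ∀ A B : C, F.obj A ⊗ F.obj B = F.obj (A ⊗ B))
    (_ : F.Monoidal), Functor.LaxMonoidal.ε F = eqToHom h₀ ∧
      ∀ A B : C, Functor.LaxMonoidal.μ F A B = eqToHom (h₂ A B)

end

end QRel

/-!
All derived-operation statements reduce to one inequality: by induction on a term `t`,
`∏ⱼ R(aⱼ, bⱼ) ^ mⱼ ≤ R(t(a), t(b))`, where `mⱼ` counts the occurrences of the `j`-th variable in
`t`. When `t` and `R` have the same kind the exponents can be removed: either `R` is relevant or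
`mⱼ ≤ 1`, so that `R(aⱼ, bⱼ) ≤ R(aⱼ, bⱼ) ^ max(mⱼ, 1)`, and either `R` is affine or `1 ≤ mⱼ`, so
that surplus factors can be absorbed into `R(t(a), t(b))`.

Hence a relation of kind `κ` stays algebraic for the derived operations of an interpretation `i` of
kind `κ`, which gives `i*`. As `i*` followed by the faithful, strict monoidal forgetful functor to
`Q`-relations is again that forgetful functor, strictness and functoriality of `i ↦ i*` need only be
checked on algebras.
-/

namespace QRel

section OrderedMonoid

variable {M : Type*}

theorem le_pow_of_le_mul_self [Monoid M] [Preorder M] [MulLeftMono M] {x : M} {m : ℕ}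
    (hx : x ≤ x * x) (hm : 1 ≤ m) : x ≤ x ^ m := by
  induction m, hm using Nat.le_induction with
  | base => rw [pow_one]
  | succ m _ ih =>
    calc x ≤ x * x := hx
      _ ≤ x * x ^ m := by gcongr
      _ = x ^ (m + 1) := (pow_succ' x m).symm

variable [CommMonoid M] [Preorder M] [IsOrderedMonoid M] {J : Type*}

theorem mul_prod_le_of_forall_mul_le {x : M} {s : Finset J} {q : J → M}
    (h : ∀ j ∈ s, x * q j ≤ x) : x * ∏ j ∈ s, q j ≤ x :=
  Finset.prod_induction q (x * · ≤ x)
    (fun p r hp hr => by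
      rw [← mul_assoc]
      exact (mul_le_mul_left hp r).trans hr)
    (mul_one x).le h

theorem prod_le_of_prod_pow_le {s : Finset J} {r : J → M} {m : J → ℕ} {x : M}
    (h : ∏ j ∈ s, r j ^ m j ≤ x) (hdup : ∀ j ∈ s, r j ≤ r j ^ max (m j) 1)
    (hdel : ∀ j ∈ s, m j = 0 → x * r j ≤ x) : ∏ j ∈ s, r j ≤ x := by
  have surplus_le : ∀ j ∈ s, x * r j ^ (1 - m j) ≤ x := by
    intro j hj
    rcases Nat.eq_zero_or_pos (m j) with hm | hm
    · simpa only [hm, Nat.sub_zero, pow_one] using hdel j hj hm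
    · rw [Nat.sub_eq_zero_of_le hm, pow_zero, mul_one]
  calc ∏ j ∈ s, r j ≤ ∏ j ∈ s, r j ^ max (m j) 1 := Finset.prod_le_prod' hdup
    _ = (∏ j ∈ s, r j ^ m j) * ∏ j ∈ s, r j ^ (1 - m j) := by
      simp only [← Finset.prod_mul_distrib, ← pow_add, add_tsub_eq_max]
    _ ≤ x * ∏ j ∈ s, r j ^ (1 - m j) := mul_le_mul_left h _
    _ ≤ x := mul_prod_le_of_forall_mul_le surplus_le

end OrderedMonoid

section MonoidalFunctors

variable {C D M : Type*} [Category* C] [Category* D] [Category* M]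

theorem functor_eq_of_comp_faithful {F G : C ⥤ D} (V : D ⥤ M) [V.Faithful]
    (hobj : ∀ X, F.obj X = G.obj X) (hV : F ⋙ V = G ⋙ V) : F = G :=
  CategoryTheory.Functor.ext hobj fun X Y f => V.map_injective <| by
    rw [Functor.map_comp, Functor.map_comp, eqToHom_map, eqToHom_map]
    exact Functor.congr_hom hV f

variable [MonoidalCategory C] [MonoidalCategory D] [MonoidalCategory M]

/-- Structure isomorphisms for `F` make it a monoidal functor as soon as a faithful monoidal
functor `V` sends them to those of a monoidal structure on `F ⋙ V`. -/
def coreMonoidalOfCompFaithful (F : C ⥤ D) (V : D ⥤ M) [V.Faithful] [V.Monoidal]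
    [(F ⋙ V).Monoidal] (εIso : 𝟙_ D ≅ F.obj (𝟙_ C))
    (μIso : ∀ A B : C, F.obj A ⊗ F.obj B ≅ F.obj (A ⊗ B))
    (hε : V.map εIso.hom = Functor.OplaxMonoidal.η V ≫ Functor.LaxMonoidal.ε (F ⋙ V))
    (hμ : ∀ A B, V.map (μIso A B).hom =
      Functor.OplaxMonoidal.δ V _ _ ≫ Functor.LaxMonoidal.μ (F ⋙ V) A B) :
    F.CoreMonoidal where
  εIso := εIso
  μIso := μIso
  μIso_hom_natural_left f Z := V.map_injective <| by
    simp only [Functor.map_comp, Functor.Monoidal.map_whiskerRight, hμ, assoc,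
      Functor.Monoidal.μ_δ_assoc]
    exact congrArg _ (Functor.LaxMonoidal.μ_natural_left (F ⋙ V) f Z)
  μIso_hom_natural_right Z f := V.map_injective <| by
    simp only [Functor.map_comp, Functor.Monoidal.map_whiskerLeft, hμ, assoc,
      Functor.Monoidal.μ_δ_assoc]
    exact congrArg _ (Functor.LaxMonoidal.μ_natural_right (F ⋙ V) Z f)
  associativity X Y Z := V.map_injective <| by
    simp only [Functor.map_comp, Functor.Monoidal.map_whiskerLeft,
      Functor.Monoidal.map_whiskerRight, Functor.Monoidal.map_associator, hμ, assoc,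
      comp_whiskerRight, MonoidalCategory.whiskerLeft_comp, Functor.Monoidal.μ_δ_assoc,
      Functor.Monoidal.whiskerLeft_μ_δ_assoc]
    exact congrArg _ (congrArg _ (Functor.LaxMonoidal.associativity (F ⋙ V) X Y Z))
  left_unitality X := V.map_injective <| by
    simp only [Functor.map_comp, Functor.Monoidal.map_whiskerRight,
      Functor.Monoidal.map_leftUnitor, hμ, hε, assoc, comp_whiskerRight,
      Functor.Monoidal.μ_δ_assoc]
    exact congrArg _ (congrArg _ (Functor.LaxMonoidal.left_unitality (F ⋙ V) X))
  right_unitality X := V.map_injective <| by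
    simp only [Functor.map_comp, Functor.Monoidal.map_whiskerLeft,
      Functor.Monoidal.map_rightUnitor, hμ, hε, assoc, MonoidalCategory.whiskerLeft_comp,
      Functor.Monoidal.μ_δ_assoc]
    exact congrArg _ (congrArg _ (Functor.LaxMonoidal.right_unitality (F ⋙ V) X))

theorem δ_eq_eqToHom {F : C ⥤ D} [F.Monoidal] {A B : C} (h : F.obj A ⊗ F.obj B = F.obj (A ⊗ B))
    (hμ : Functor.LaxMonoidal.μ F A B = eqToHom h) :
    Functor.OplaxMonoidal.δ F A B = eqToHom h.symm := by
  rw [← cancel_epi (Functor.LaxMonoidal.μ F A B), Functor.Monoidal.μ_δ, hμ, eqToHom_trans,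
    eqToHom_refl]

theorem η_eq_eqToHom {F : C ⥤ D} [F.Monoidal] (h : 𝟙_ D = F.obj (𝟙_ C))
    (hε : Functor.LaxMonoidal.ε F = eqToHom h) : Functor.OplaxMonoidal.η F = eqToHom h.symm := by
  rw [← cancel_epi (Functor.LaxMonoidal.ε F), Functor.Monoidal.ε_η, hε, eqToHom_trans, eqToHom_refl]

theorem IsStrictMonoidal.of_comp_faithful {F : C ⥤ D} {V : D ⥤ M} [V.Faithful]
    (hV : IsStrictMonoidal V) (hFV : IsStrictMonoidal (F ⋙ V)) (h₀ : 𝟙_ D = F.obj (𝟙_ C))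
    (h₂ : ∀ A B : C, F.obj A ⊗ F.obj B = F.obj (A ⊗ B)) : IsStrictMonoidal F := by
  obtain ⟨_, _, _, hεV, hμV⟩ := hV
  obtain ⟨_, _, _, hεFV, hμFV⟩ := hFV
  refine ⟨h₀, h₂, (coreMonoidalOfCompFaithful F V (eqToIso h₀) (fun A B => eqToIso (h₂ A B))
    ?_ fun A B => ?_).toMonoidal, rfl, fun _ _ => rfl⟩
  · rw [η_eq_eqToHom _ hεV, hεFV, eqToIso.hom, eqToHom_map, eqToHom_trans]
  · rw [δ_eq_eqToHom _ (hμV _ _), hμFV, eqToIso.hom, eqToHom_map, eqToHom_trans]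

end MonoidalFunctors

section DerivedOperations

variable {E : Type u} [Category.{v} E] [HasFiniteLimits E]

namespace SigStructure

variable {S T U : Signature.{w}} {m n : ℕ}

theorem app_var (A : SigStructure E S) (i : Fin n) {X : E} (a : Fin n → (X ⟶ A.carrier)) :
    A.app (.var i) a = a i :=
  limit.lift_π _ _

theorem app_op (A : SigStructure E S) (σ : S.Op) (ts : Fin (S.arity σ) → Term S n) {X : E}
    (a : Fin n → (X ⟶ A.carrier)) :
    A.app (.op σ ts) a = A.opApp σ fun j => A.app (ts j) a := by
  have lift_comp : Pi.lift a ≫ Pi.lift (fun j => A.eval (ts j)) =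
      Pi.lift fun j => A.app (ts j) a :=
    Pi.hom_ext _ _ fun j => by simp only [assoc, limit.lift_π, Fan.mk_π_app, app]
  rw [app, eval, ← assoc, lift_comp, opApp]

theorem eval_op_var (A : SigStructure E S) (σ : S.Op) : A.eval (.op σ .var) = A.op σ := by
  have lift_π : Pi.lift (fun j => A.eval (.var j)) = 𝟙 (power A.carrier (S.arity σ)) :=
    Pi.hom_ext _ _ fun j => by simp only [limit.lift_π, Fan.mk_π_app, eval, id_comp]
  rw [eval, lift_π, id_comp]

theorem eval_subst (A : SigStructure E S) (s : Fin m → Term S n) (t : Term S m) :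
    A.eval (t.subst s) = A.app t fun i => A.eval (s i) := by
  induction t with
  | var i => exact (A.app_var i fun j => A.eval (s j)).symm
  | op σ ts ih =>
    rw [app_op, ← funext ih]
    rfl

theorem eval_reduct (f : ∀ σ : S.Op, Term T (S.arity σ)) (A : SigStructure E T) (t : Term S n) :
    (A.reduct f).eval t = A.eval (t.translate f) := by
  induction t with
  | var i => rfl
  | op σ ts ih =>
    rw [Term.translate, eval_subst, ← funext ih]
    rfl

theorem reduct_op_var (A : SigStructure E S) : A.reduct (fun σ => .op σ .var) = A :=
  congrArg (SigStructure.mk A.carrier) (funext A.eval_op_var)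

theorem reduct_reduct (f : ∀ σ : S.Op, Term T (S.arity σ)) (g : ∀ σ : T.Op, Term U (T.arity σ))
    (A : SigStructure E U) :
    (A.reduct g).reduct f = A.reduct fun σ => (f σ).translate g :=
  congrArg (SigStructure.mk A.carrier) (funext fun σ => eval_reduct g A (f σ))

variable [CartesianMonoidalCategory E]

theorem reduct_prod (f : ∀ σ : S.Op, Term T (S.arity σ)) (A B : SigStructure E T) :
    (A.prod B).reduct f = (A.reduct f).prod (B.reduct f) :=
  congrArg (SigStructure.mk (A.carrier ⊗ B.carrier)) (funext fun σ => prod_eval A B (f σ))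

theorem reduct_terminal (f : ∀ σ : S.Op, Term T (S.arity σ)) :
    (terminal E T).reduct f = terminal E S :=
  congrArg (SigStructure.mk (𝟙_ E)) (funext fun _ => toUnit_unique _ _)

end SigStructure

namespace Algebra

variable {P P' : Presentation.{w}}

theorem toSigStructure_injective :
    Function.Injective (toSigStructure : Algebra E P → SigStructure E P.toSignature) := by
  rintro ⟨A, _⟩ ⟨_, _⟩ rfl
  rfl

theorem eval_eq_of_provable (A : Algebra E P) {n : ℕ} {s t : Term P.toSignature n}
    (h : Provable P s t) : A.eval s = A.eval t := by
  induction h with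
  | ax h r => simp only [SigStructure.eval_subst, SigStructure.app, A.sat h]
  | refl t => rfl
  | symm _ ih => exact ih.symm
  | trans _ _ ih₁ ih₂ => exact ih₁.trans ih₂
  | congr σ _ ih => simp only [SigStructure.eval, ih]

/-- The algebra `i*(A)` on the carrier of `A` whose operations are the derived operations
of the terms assigned by the interpretation `i`. -/
noncomputable def reinterpret {κ : Kind} (i : Interpretation κ P P') (A : Algebra E P') :
    Algebra E P where
  toSigStructure := A.toSigStructure.reduct i.term
  sat h := by
    rw [SigStructure.eval_reduct, SigStructure.eval_reduct]
    exact A.eval_eq_of_provable (i.provable h)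

end Algebra

end DerivedOperations

section AlgebraicRelations

variable {E : Type u} [Category.{v} E] [HasFiniteLimits E] {Q : E} {κ : Kind}
  {P P' : Presentation.{w}}

theorem AlgRel.toSigStructure_injective :
    Function.Injective fun A : AlgRel Q κ P => A.alg.toSigStructure :=
  fun _ _ h => congrArg mk (Algebra.toSigStructure_injective h)

variable [CartesianMonoidalCategory E] [MonoidalClosed E] [HasSubobjectClassifier E]
  [MonObj Q] [InternalQuantale Q] {S : Signature.{w}} {n : ℕ} {t : Term S n}

theorem RelHasKind.isRelevant_or_count_le_one {A B : E} {R : A ⊗ B ⟶ Q} (hR : RelHasKind R κ)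
    (ht : t.HasKind κ) : IsRelevant R ∨ ∀ i, t.count i ≤ 1 := by
  cases κ with
  | linear => exact .inr fun i => (ht i).le
  | affine => exact .inr ht
  | relevant => exact .inl hR
  | cartesian => exact .inl hR.2

theorem RelHasKind.isAffine_or_one_le_count {A B : E} {R : A ⊗ B ⟶ Q} (hR : RelHasKind R κ)
    (ht : t.HasKind κ) : IsAffine R ∨ ∀ i, 1 ≤ t.count i := by
  cases κ with
  | linear => exact .inr fun i => (ht i).ge
  | affine => exact .inl hR
  | relevant => exact .inr ht
  | cartesian => exact .inl hR.1

variable [BraidedCategory E] [IsCommMonObj Q]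

instance homIsOrderedMonoid (X : E) : IsOrderedMonoid (X ⟶ Q) where
  mul_le_mul_left _ _ h _ := mul_mono h le_rfl

variable {A B : SigStructure E S} {R : A.carrier ⊗ B.carrier ⟶ Q}

theorem IsAlgebraic.prod_pow_count_le_app (hR : IsAlgebraic A B R) (t : Term S n) {X : E}
    (a : Fin n → (X ⟶ A.carrier)) (b : Fin n → (X ⟶ B.carrier)) :
    ∏ j, ev R (a j) (b j) ^ t.count j ≤ ev R (A.app t a) (B.app t b) := by
  induction t with
  | var i =>
    rw [SigStructure.app_var, SigStructure.app_var]
    simp [Term.count, pow_ite]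
  | op σ ts ih =>
    calc ∏ j, ev R (a j) (b j) ^ (Term.op σ ts).count j
        = ∏ k, ∏ j, ev R (a j) (b j) ^ (ts k).count j := by
          simp only [Term.count, ← Finset.prod_pow_eq_pow_sum]
          exact Finset.prod_comm
      _ ≤ ∏ k, ev R (A.app (ts k) a) (B.app (ts k) b) := Finset.prod_le_prod' fun k _ => ih k
      _ ≤ ev R (A.app (.op σ ts) a) (B.app (.op σ ts) b) := by
          rw [SigStructure.app_op, SigStructure.app_op]
          exact hR σ _ _

theorem IsAlgebraic.prod_le_app (hR : IsAlgebraic A B R) (hκ : RelHasKind R κ)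
    (ht : t.HasKind κ) {X : E} (a : Fin n → (X ⟶ A.carrier)) (b : Fin n → (X ⟶ B.carrier)) :
    ∏ j, ev R (a j) (b j) ≤ ev R (A.app t a) (B.app t b) := by
  refine prod_le_of_prod_pow_le (hR.prod_pow_count_le_app t a b) (fun j _ => ?_) fun j _ hj => ?_
  · rcases hκ.isRelevant_or_count_le_one ht with relevant | le_one
    · exact le_pow_of_le_mul_self (relevant _ _) (le_max_right _ _)
    · rw [max_eq_right (le_one j), pow_one]
  · rcases hκ.isAffine_or_one_le_count ht with affine | one_le
    · exact affine _ _ _ _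
    · exact absurd hj (Nat.one_le_iff_ne_zero.mp (one_le j))

namespace AlgRel

theorem isStrictMonoidal_forget : IsStrictMonoidal (forget Q κ P) := by
  have associativity : ∀ X Y Z : RelObj Q, 𝟙 (X ⊗ Y) ▷ Z ≫ 𝟙 ((X ⊗ Y) ⊗ Z) ≫ (α_ X Y Z).hom =
      (α_ X Y Z).hom ≫ X ◁ 𝟙 (Y ⊗ Z) ≫ 𝟙 (X ⊗ Y ⊗ Z) := by simp
  have left_unitality : ∀ X : RelObj Q,
      (λ_ X).hom = 𝟙 (𝟙_ (RelObj Q)) ▷ X ≫ 𝟙 (𝟙_ (RelObj Q) ⊗ X) ≫ (λ_ X).hom := by simp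
  have right_unitality : ∀ X : RelObj Q,
      (ρ_ X).hom = X ◁ 𝟙 (𝟙_ (RelObj Q)) ≫ 𝟙 (X ⊗ 𝟙_ (RelObj Q)) ≫ (ρ_ X).hom := by simp
  let core : (forget Q κ P).CoreMonoidal :=
    { εIso := Iso.refl _
      μIso := fun _ _ => Iso.refl _
      μIso_hom_natural_left := fun _ _ => (comp_id _).trans (id_comp _).symm
      μIso_hom_natural_right := fun _ _ => (comp_id _).trans (id_comp _).symm
      associativity := fun _ _ _ => associativity _ _ _
      left_unitality := fun _ => left_unitality _
      right_unitality := fun _ => right_unitality _ }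
  exact ⟨rfl, fun _ _ => rfl, core.toMonoidal, rfl, fun _ _ => rfl⟩

/-- The functor `i*` induced by an interpretation `i`. -/
noncomputable def reinterpret (i : Interpretation κ P P') : AlgRel Q κ P' ⥤ AlgRel Q κ P where
  obj A := ⟨A.alg.reinterpret i⟩
  map R :=
    { rel := R.rel
      isAlgebraic := fun σ _ a b => R.isAlgebraic.prod_le_app R.hasKind (i.hasKind σ) a b
      hasKind := R.hasKind }

theorem reinterpret_comp_forget (i : Interpretation κ P P') :
    reinterpret i ⋙ forget Q κ P = forget Q κ P' :=
  rfl

theorem isStrictMonoidal_reinterpret (i : Interpretation κ P P') :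
    IsStrictMonoidal (reinterpret (Q := Q) i) :=
  .of_comp_faithful isStrictMonoidal_forget
    ((reinterpret_comp_forget (Q := Q) i).symm ▸ isStrictMonoidal_forget)
    (toSigStructure_injective (SigStructure.reduct_terminal i.term).symm)
    fun A B => toSigStructure_injective
      (SigStructure.reduct_prod i.term A.alg.toSigStructure B.alg.toSigStructure).symm

theorem reinterpret_id (P : SigCat.{w} κ) : reinterpret (𝟙 P) = 𝟭 (AlgRel Q κ P.pres) :=
  functor_eq_of_comp_faithful (forget Q κ P.pres)
    (fun A => toSigStructure_injective A.alg.toSigStructure.reduct_op_var)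
    rfl

theorem reinterpret_comp {P₁ P₂ P₃ : SigCat.{w} κ} (i : P₁ ⟶ P₂) (j : P₂ ⟶ P₃) :
    reinterpret (Q := Q) (i ≫ j) = reinterpret j ⋙ reinterpret i :=
  functor_eq_of_comp_faithful (forget Q κ P₁.pres)
    (fun A => toSigStructure_injective
      (SigStructure.reduct_reduct i.term j.term A.alg.toSigStructure).symm)
    rfl

end AlgRel

end AlgebraicRelations

end QRel

theorem mainTheorem7 {E : Type u} [Category.{v} E] [CartesianMonoidalCategory E]
    [BraidedCategory E] [HasFiniteLimits E] [MonoidalClosed E] [HasSubobjectClassifier E]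
    (Q : E) [MonObj Q] [IsCommMonObj Q] [QRel.InternalQuantale Q] (κ : QRel.Kind) :
    (∃ star : ∀ {P₁ P₂ : QRel.SigCat.{w} κ}, (P₁ ⟶ P₂) →
        (QRel.AlgRel Q κ P₂.pres ⥤ QRel.AlgRel Q κ P₁.pres),
      (∀ {P₁ P₂ : QRel.SigCat.{w} κ} (i : P₁ ⟶ P₂), QRel.IsStrictMonoidal (star i)) ∧
      (∀ {P₁ P₂ : QRel.SigCat.{w} κ} (i : P₁ ⟶ P₂) (A : QRel.AlgRel Q κ P₂.pres),
        ((star i).obj A).alg.toSigStructure = A.alg.reduct i.term) ∧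
      (∀ {P₁ P₂ : QRel.SigCat.{w} κ} (i : P₁ ⟶ P₂),
        star i ⋙ QRel.AlgRel.forget Q κ P₁.pres = QRel.AlgRel.forget Q κ P₂.pres) ∧
      (∀ P : QRel.SigCat.{w} κ, star (𝟙 P) = 𝟭 (QRel.AlgRel Q κ P.pres)) ∧
      (∀ {P₁ P₂ P₃ : QRel.SigCat.{w} κ} (i : P₁ ⟶ P₂) (j : P₂ ⟶ P₃),
        star (i ≫ j) = star j ⋙ star i)) ∧
    (∀ (P : QRel.Presentation.{w}) (A B : QRel.AlgRel Q κ P) (R : A ⟶ B) (n : ℕ)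
      (t : QRel.Term P.toSignature n), t.HasKind κ →
      ∀ {X : E} (a : Fin n → (X ⟶ A.alg.carrier)) (b : Fin n → (X ⟶ B.alg.carrier)),
        ∏ j, QRel.ev R.rel (a j) (b j) ≤ QRel.ev R.rel (A.alg.app t a) (B.alg.app t b)) := by
  refine ⟨⟨fun i => QRel.AlgRel.reinterpret i, fun i => QRel.AlgRel.isStrictMonoidal_reinterpret i,
    fun i A => rfl, fun i => QRel.AlgRel.reinterpret_comp_forget i, QRel.AlgRel.reinterpret_id,
    QRel.AlgRel.reinterpret_comp⟩, ?_⟩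
  intro P A B R n t ht X a b
  exact R.isAlgebraic.prod_le_app R.hasKind ht a b
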